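/- **Definitions.** A permutation of size $n$ is a word $\sigma=\sigma_1\cdots\sigma_n$ containing each of $1,\dots,n$ exactly once. A (non-empty) interval of $\sigma$ is a non-empty set $\{a,a+1,\dots,b\}$ of consecutive values of the form $\{\sigma_i,\sigma_{i+1},\dots,\sigma_j\}$ with $i\le j$. The interval poset $\tilde P(\sigma)$ is the set of non-empty intervals of $\sigma$ ordered by inclusion, embedded in the plane so that its minimal elements appear in the order $\{\sigma_1\},\{\sigma_2\},\dots,\{\sigma_n\}$ from left to right; its elements are not labelled, so two interval posets are equal when there is an isomorphism of posets between them that preserves the left-to-right order of the minimal elements. A realizer of an interval poset $P$ is a permutation $\tau$ with $\tilde P(\tau)=P$. A permutation is separable if it avoids the patterns $2413$ and $3142$. The little Schröder numbers are indexed by $s_1=s_2=1$, $s_3=3$, $s_4=11$, $s_5=45,\dots$; that is, for $n\ge 2$, $2s_n=S_{n-1}$, where $S_0=1$ and $S_{m+1}=S_m+\sum_{i=0}^{m}S_iS_{m-i}$ are the large Schröder numbers. **Theorem.** For every permutation $\sigma$, the interval poset $\tilde P(\sigma)$ has exactly two realizers if and only if $\sigma$ is a separable permutation of size at least $2$, or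 $\sigma=2413$, or $\sigma=3142$. Consequently, the number $a_n$ of interval posets with $n$ minimal elements (equivalently, of permutations of size $n$) that have exactly two realizers is given by $a_1=0$, $a_2=s_2=1$, $a_3=s_3=3$, $a_4=s_4+1=12$, and $a_n=s_n$ for all $n\ge 5$. -/

import Mathlib

/-- A poset together with a left-to-right order on its minimal elements. -/
structure PlanePoset where
  carrier : Type
  order : PartialOrder carrier
  /-- `leftOf x y` : the minimal element `x` lies to the left of the minimal element `y`. -/
  leftOf : {x : carrier // IsMin x} → {x : carrier // IsMin x} → Prop
  strictTotal : IsStrictTotalOrder {x : carrier // IsMin x} leftOf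

attribute [instance] PlanePoset.order

/-- Two plane posets are the same when there is an isomorphism of posets that preserves
the left-to-right order of the minimal elements. -/
def PlanePoset.Iso (P Q : PlanePoset) : Prop :=
  ∃ e : P.carrier ≃o Q.carrier, ∀ x y : {x : P.carrier // IsMin x},
    P.leftOf x y ↔
      Q.leftOf ⟨e x.1, e.isMin_apply.2 x.2⟩ ⟨e y.1, e.isMin_apply.2 y.2⟩

theorem PlanePoset.iso_equivalence : Equivalence PlanePoset.Iso where
  refl P := ⟨OrderIso.refl _, fun _ _ => Iff.rfl⟩
  symm := by
    rintro P Q ⟨e, he⟩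
    refine ⟨e.symm, fun x y => ?_⟩
    rw [he]
    simp
  trans := by
    rintro P Q R ⟨e, he⟩ ⟨f, hf⟩
    exact ⟨e.trans f, fun x y => (he x y).trans (hf _ _)⟩

instance PlanePoset.setoid : Setoid PlanePoset := ⟨PlanePoset.Iso, PlanePoset.iso_equivalence⟩

/-- Plane posets up to isomorphism. -/
abbrev UnlabeledPlanePoset : Type 1 := Quotient PlanePoset.setoid

/-- A permutation of some size `n`; the word `σ₁ ⋯ σₙ` is indexed from `0`, with values in
`{0, …, n - 1}`. -/
abbrev Permutation : Type := Σ n : ℕ, Equiv.Perm (Fin n)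

/-- A nonempty interval of `σ`: a nonempty interval of values which is the image by `σ` of an
interval of positions. -/
def IsPermInterval {n : ℕ} (σ : Equiv.Perm (Fin n)) (I : Set (Fin n)) : Prop :=
  I.Nonempty ∧ (∃ a b : Fin n, I = Set.Icc a b) ∧ ∃ i j : Fin n, I = σ '' Set.Icc i j

/-- The nonempty intervals of `σ`, ordered by inclusion. -/
abbrev PermInterval {n : ℕ} (σ : Equiv.Perm (Fin n)) : Type :=
  {I : Set (Fin n) // IsPermInterval σ I}

theorem isPermInterval_singleton {n : ℕ} (σ : Equiv.Perm (Fin n)) (i : Fin n) :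
    IsPermInterval σ {σ i} :=
  ⟨Set.singleton_nonempty _, ⟨σ i, σ i, by simp⟩, ⟨i, i, by simp⟩⟩

/-- The minimal elements are the singletons. -/
theorem PermInterval.exists_eq_of_isMin {n : ℕ} (σ : Equiv.Perm (Fin n)) (I : PermInterval σ)
    (hI : IsMin I) : ∃ i, I.1 = {σ i} := by
  obtain ⟨v, hv⟩ := I.2.1
  refine ⟨σ.symm v, ?_⟩
  have hs : ({σ (σ.symm v)} : Set (Fin n)) ⊆ I.1 := by simpa using hv
  exact Set.Subset.antisymm (hI (b := ⟨_, isPermInterval_singleton σ (σ.symm v)⟩) hs) hs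

/-- The modified interval poset of `σ`: its nonempty intervals ordered by inclusion, the minimal
elements being `{σ₁}, {σ₂}, …, {σₙ}` from left to right. -/
def intervalPlanePoset {n : ℕ} (σ : Equiv.Perm (Fin n)) : PlanePoset where
  carrier := PermInterval σ
  order := inferInstance
  leftOf X Y := ∃ i j : Fin n, i < j ∧ X.1.1 = {σ i} ∧ Y.1.1 = {σ j}
  strictTotal :=
    { irrefl := by
        rintro X ⟨i, j, hij, h1, h2⟩
        have : i = j := by simpa using h1.symm.trans h2
        exact hij.ne this
      trans := by
        rintro X Y Z ⟨i, j, hij, h1, h2⟩ ⟨k, l, hkl, h3, h4⟩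
        have : j = k := by simpa using h2.symm.trans h3
        subst this
        exact ⟨i, l, hij.trans hkl, h1, h4⟩
      trichotomous := by
        intro X Y hXY hYX
        obtain ⟨i, hi⟩ := PermInterval.exists_eq_of_isMin σ X.1 X.2
        obtain ⟨j, hj⟩ := PermInterval.exists_eq_of_isMin σ Y.1 Y.2
        rcases lt_trichotomy i j with h | h | h
        · exact absurd ⟨i, j, h, hi, hj⟩ hXY
        · subst h
          exact Subtype.ext (Subtype.ext (hi.trans hj.symm))
        · exact absurd ⟨j, i, h, hj, hi⟩ hYX }

/-- The modified interval poset `P̃(σ)`, as a plane poset without labels. -/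
def intervalPoset (σ : Permutation) : UnlabeledPlanePoset :=
  Quotient.mk PlanePoset.setoid (intervalPlanePoset σ.2)

/-- The realizers of `P`: the permutations `σ`, of whatever size, with `P̃(σ) = P`. -/
def realizers (P : UnlabeledPlanePoset) : Set Permutation :=
  {σ | intervalPoset σ = P}

/-- The interval posets of permutations of size `n`, i.e. the interval posets with `n` minimal
elements, that have exactly two realizers. -/
def twoRealizerPosets (n : ℕ) : Set UnlabeledPlanePoset :=
  {P | (∃ σ : Equiv.Perm (Fin n), intervalPoset ⟨n, σ⟩ = P) ∧ (realizers P).encard = 2}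

/-- `σ` contains the pattern `π`: some subsequence of `σ` is order-isomorphic to `π`. -/
def ContainsPattern {n k : ℕ} (σ : Equiv.Perm (Fin n)) (π : Equiv.Perm (Fin k)) : Prop :=
  ∃ f : Fin k → Fin n, StrictMono f ∧ ∀ a b : Fin k, σ (f a) < σ (f b) ↔ π a < π b

/-- The permutation `2413`. -/
def perm2413 : Equiv.Perm (Fin 4) where
  toFun := ![1, 3, 0, 2]
  invFun := ![2, 0, 3, 1]
  left_inv := by decide
  right_inv := by decide

/-- The permutation `3142`. -/
def perm3142 : Equiv.Perm (Fin 4) where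
  toFun := ![2, 0, 3, 1]
  invFun := ![1, 3, 0, 2]
  left_inv := by decide
  right_inv := by decide

/-- A permutation is separable if it avoids the patterns `2413` and `3142`. -/
def IsSeparablePerm {n : ℕ} (σ : Equiv.Perm (Fin n)) : Prop :=
  ¬ ContainsPattern σ perm2413 ∧ ¬ ContainsPattern σ perm3142

/-! An isomorphism of interval posets matches atoms in left-to-right order, so the poset records
exactly which position ranges are blocks (`intervalPoset_eq_iff`). Only the relative order of
letters matters, so the argument runs on integer words over `[a, b)`. Reversing values keeps all
blocks; for size at least two there are thus always two realizers, and the question is when a third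
exists.

A separable word splits as a direct or skew sum (`AvoidsOn.exists_splitAt`). Any word with the same
blocks splits at the same place; after a global reversal the signs agree and induction applies to
both parts. Reversing a single part would destroy a block straddling the split, so there is no third
realizer (`AvoidsOn.rigid`).

For a non-separable word of length at least five, take a minimal block containing a forbidden
pattern; it is indecomposable. If it is proper, no block crosses it and reversing its values yields
a third word. If it is the whole word and the word is not simple, reverse a maximal proper block
instead. If the word is simple, it shares its blocks with every simple word of that length, among
which `zigzag` and `zigzag'` are neither equal nor mutually reversed in order
(`HasThird.of_not_avoidsOn`). In size four the only non-separable permutations are 2413 and 3142,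
complements of each other.

For the count, complementation pairs the sum-indecomposable separable permutations with the others,
and removing the first sum component gives the large Schröder recurrence. Each poset counted has
exactly two realizers, which halves the number. -/

/-! ### Words, blocks and splits -/

/-- The positions `i, …, j - 1` carry an interval of the word `f` restricted to `[a, b)`: no letter
outside lies strictly between two letters inside. -/
def IsBlock (f : ℕ → ℤ) (a b i j : ℕ) : Prop :=
  a ≤ i ∧ i < j ∧ j ≤ b ∧ ∀ k x y, a ≤ k → k < b → (k < i ∨ j ≤ k) → i ≤ x → x < j → i ≤ y → y < j →
    f x < f k → ¬ f k < f y

/-- The word `f` on `[a, b)` is the direct sum of its restrictions to `[a, c)` and `[c, b)`. -/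
def SumAt (f : ℕ → ℤ) (a b c : ℕ) : Prop :=
  ∀ x y, a ≤ x → x < c → c ≤ y → y < b → f x < f y

/-- The word `f` on `[a, b)` is the direct sum or the skew sum of its restrictions to `[a, c)` and
`[c, b)`. -/
def SplitAt (f : ℕ → ℤ) (a b c : ℕ) : Prop :=
  SumAt f a b c ∨ SumAt (-f) a b c

/-- The word `f` on `[a, b)` avoids `2413` and `3142`. -/
def AvoidsOn (f : ℕ → ℤ) (a b : ℕ) : Prop :=
  ∀ p q r s, a ≤ p → p < q → q < r → r < s → s < b →
    ¬ (f r < f p ∧ f p < f s ∧ f s < f q) ∧ ¬ (f q < f s ∧ f s < f p ∧ f p < f r)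

/-- The words `f` and `g` are order-isomorphic on `[a, b)`. -/
def SameOrder (f g : ℕ → ℤ) (a b : ℕ) : Prop :=
  ∀ x y, a ≤ x → x < b → a ≤ y → y < b → (f x < f y ↔ g x < g y)

/-- The words `f` and `g` have the same intervals on `[a, b)`. -/
def SameBlocks (f g : ℕ → ℤ) (a b : ℕ) : Prop :=
  ∀ i j, IsBlock f a b i j ↔ IsBlock g a b i j

variable {f g : ℕ → ℤ} {a b c i j p q n : ℕ}

theorem IsBlock.neg (h : IsBlock f a b i j) : IsBlock (-f) a b i j := by
  refine ⟨h.1, h.2.1, h.2.2.1, fun k x y h1 h2 h3 h4 h5 h6 h7 h8 h9 => ?_⟩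
  simp only [Pi.neg_apply] at h8 h9
  exact h.2.2.2 k y x h1 h2 h3 h6 h7 h4 h5 (by omega) (by omega)

theorem isBlock_neg : IsBlock (-f) a b i j ↔ IsBlock f a b i j :=
  ⟨fun h => by simpa using h.neg, IsBlock.neg⟩

theorem sameBlocks_neg_left : SameBlocks (-f) g a b ↔ SameBlocks f g a b := by
  simp [SameBlocks, isBlock_neg]

theorem sameBlocks_neg_right : SameBlocks f (-g) a b ↔ SameBlocks f g a b := by
  simp [SameBlocks, isBlock_neg]

theorem SameBlocks.symm (h : SameBlocks f g a b) : SameBlocks g f a b := fun i j => (h i j).symm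

theorem SameOrder.symm (h : SameOrder f g a b) : SameOrder g f a b :=
  fun x y h1 h2 h3 h4 => (h x y h1 h2 h3 h4).symm

theorem SameOrder.trans {k : ℕ → ℤ} (h : SameOrder f g a b) (h' : SameOrder g k a b) :
    SameOrder f k a b :=
  fun x y h1 h2 h3 h4 => (h x y h1 h2 h3 h4).trans (h' x y h1 h2 h3 h4)

theorem SameBlocks.trans {k : ℕ → ℤ} (h : SameBlocks f g a b) (h' : SameBlocks g k a b) :
    SameBlocks f k a b :=
  fun i j => (h i j).trans (h' i j)

theorem SameOrder.neg (h : SameOrder f g a b) : SameOrder (-f) (-g) a b := by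
  intro x y h1 h2 h3 h4
  simpa using h y x h3 h4 h1 h2

theorem SameOrder.sameBlocks (h : SameOrder f g a b) : SameBlocks f g a b := by
  have key : ∀ {f g : ℕ → ℤ}, SameOrder f g a b → ∀ i j, IsBlock f a b i j → IsBlock g a b i j := by
    intro f g h i j hb
    refine ⟨hb.1, hb.2.1, hb.2.2.1, fun k x y h1 h2 h3 h4 h5 h6 h7 h8 h9 => ?_⟩
    have := hb.1
    have := hb.2.2.1
    exact hb.2.2.2 k x y h1 h2 h3 h4 h5 h6 h7
      ((h x k (by omega) (by omega) (by omega) (by omega)).2 h8)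
      ((h k y (by omega) (by omega) (by omega) (by omega)).2 h9)
  exact fun i j => ⟨key h i j, key h.symm i j⟩

theorem AvoidsOn.neg (h : AvoidsOn f a b) : AvoidsOn (-f) a b := by
  intro p q r s h1 h2 h3 h4 h5
  have := h p q r s h1 h2 h3 h4 h5
  simp only [Pi.neg_apply]
  omega

theorem AvoidsOn.mono (h : AvoidsOn f a b) (hi : a ≤ i) (hj : j ≤ b) : AvoidsOn f i j :=
  fun p q r s h1 h2 h3 h4 h5 => h p q r s (by omega) h2 h3 h4 (by omega)

theorem AvoidsOn.congr (h : AvoidsOn f a b) (hfg : SameOrder f g a b) : AvoidsOn g a b := by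
  intro p q r s h1 h2 h3 h4 h5
  have := h p q r s h1 h2 h3 h4 h5
  rw [hfg r p, hfg p s, hfg s q, hfg q s, hfg s p, hfg p r] at this <;> omega

theorem SplitAt.neg (h : SplitAt f a b c) : SplitAt (-f) a b c :=
  h.symm.imp id fun h => by simpa using h

theorem SumAt.congr (h : SumAt f a b c) (hfg : SameOrder f g a b) (hc : a ≤ c) (hcb : c ≤ b) :
    SumAt g a b c :=
  fun x y h1 h2 h3 h4 => (hfg x y h1 (h2.trans_le hcb) (hc.trans h3) h4).1 (h x y h1 h2 h3 h4)

theorem SplitAt.congr (h : SplitAt f a b c) (hfg : SameOrder f g a b) (hc : a ≤ c) (hc' : c ≤ b) :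
    SplitAt g a b c :=
  h.imp (fun h => h.congr hfg hc hc') fun h => h.congr hfg.neg hc hc'

theorem SumAt.mono (h : SumAt f a b c) (hi : a ≤ i) (hj : j ≤ b) : SumAt f i j c :=
  fun x y h1 h2 h3 h4 => h x y (by omega) h2 h3 (by omega)

theorem SplitAt.mono (h : SplitAt f a b c) (hi : a ≤ i) (hj : j ≤ b) : SplitAt f i j c :=
  h.imp (fun h => h.mono hi hj) fun h => h.mono hi hj

/-- An occurrence straddling `c` has its first letter below its last, which excludes 3142. In 2413,
the third letter can lie on neither side of `c`. -/
theorem AvoidsOn.of_sumAt (h : SumAt f a b c) (h1 : AvoidsOn f a c) (h2 : AvoidsOn f c b) :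
    AvoidsOn f a b := by
  intro p q r s hp hq hr hs hb
  by_cases hsc : s < c
  · exact h1 p q r s hp hq hr hs hsc
  by_cases hpc : c ≤ p
  · exact h2 p q r s hpc hq hr hs hb
  have e1 := h p s hp (by omega) (by omega) hb
  constructor
  · rintro ⟨h3, h4, h5⟩
    by_cases hrc : r < c
    · have := h q s (by omega) (by omega) (by omega) hb
      omega
    · have := h p r hp (by omega) (by omega) (by omega)
      omega
  · omega

theorem AvoidsOn.of_splitAt (h : SplitAt f a b c) (h1 : AvoidsOn f a c) (h2 : AvoidsOn f c b) :
    AvoidsOn f a b := by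
  rcases h with h | h
  · exact .of_sumAt h h1 h2
  · simpa using (AvoidsOn.of_sumAt h h1.neg h2.neg).neg

/-! ### Splitting separable words -/

/-- If a word avoiding `2413` and `3142` is a direct sum up to its last letter, then it is a direct
sum or a skew sum. -/
theorem AvoidsOn.exists_splitAt_of_sumAt (hf : Set.InjOn f (Set.Ico a (b + 1)))
    (h : AvoidsOn f a (b + 1)) (hac : a < c) (hcb : c < b) (hs : SumAt f a b c) :
    ∃ d, a < d ∧ d < b + 1 ∧ SplitAt f a (b + 1) d := by
  have hne : ∀ x, a ≤ x → x < b → f x ≠ f b := fun x h1 h2 h3 => by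
    have := hf (show x ∈ Set.Ico a (b + 1) from ⟨h1, by omega⟩) ⟨by omega, by omega⟩ h3
    omega
  by_cases hA : ∀ x, a ≤ x → x < c → f x < f b
  · refine ⟨c, hac, by omega, Or.inl fun x y h1 h2 h3 h4 => ?_⟩
    rcases Nat.lt_succ_iff_lt_or_eq.1 h4 with h5 | rfl
    · exact hs x y h1 h2 h3 h5
    · exact hA x h1 h2
  push Not at hA
  obtain ⟨u, hu1, hu2, hu3⟩ := hA
  have hbig : ∀ y, c ≤ y → y < b → f b < f y := fun y h1 h2 => by
    have := hs u y hu1 hu2 h1 h2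
    omega
  classical
  -- The candidate split is at the first letter `d` above the last letter.
  have hex : ∃ d, a ≤ d ∧ d < c ∧ f b < f d := ⟨u, hu1, hu2, by have := hne u hu1 (by omega); omega⟩
  obtain ⟨hd1, hd2, hd3⟩ := Nat.find_spec hex
  have hmin : ∀ x, a ≤ x → x < Nat.find hex → f x < f b := fun x h1 h2 => by
    have h3 := Nat.find_min hex h2
    have h4 := hne x h1 (by omega)
    by_contra h5
    exact h3 ⟨h1, by omega, by omega⟩
  generalize Nat.find hex = d at *
  -- A smaller letter `l` after `d` in the left part would make `d, l, c, b` an occurrence of 3142.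
  by_cases hL : ∃ l, a ≤ l ∧ l < c ∧ f l < f b ∧ d < l
  · obtain ⟨l, hl1, hl2, hl3, hl4⟩ := hL
    have h1 := h d l c b hd1 hl4 hl2 hcb (by omega)
    have h2 := hs d c hd1 hd2 le_rfl hcb
    exact absurd ⟨hl3, hd3, h2⟩ h1.2
  have hU : ∀ x, d ≤ x → x < b → f b < f x := fun x h1 h2 => by
    rcases lt_or_ge x c with h3 | h3
    · rcases h1.eq_or_lt with rfl | h4
      · exact hd3
      have := hne x (by omega) h2
      by_contra h5
      exact hL ⟨x, by omega, h3, by omega, h4⟩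
    · exact hbig x h3 h2
  -- If `d = a`, every letter exceeds the last one, which splits off as a skew sum; otherwise the
  -- word is a direct sum at `d`.
  rcases hd1.eq_or_lt with rfl | hd4
  · refine ⟨b, by omega, by omega, Or.inr fun x y h1 h2 h3 h4 => ?_⟩
    obtain rfl : y = b := by omega
    simpa using hU x h1 h2
  · refine ⟨d, hd4, by omega, Or.inl fun x y h1 h2 h3 h4 => ?_⟩
    have e1 := hmin x h1 h2
    rcases Nat.lt_succ_iff_lt_or_eq.1 h4 with h5 | rfl
    · exact e1.trans (hU y h3 h5)
    · exact e1

theorem injOn_neg {s : Set ℕ} (hf : Set.InjOn f s) : Set.InjOn (-f) s := fun x hx y hy h =>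
  hf hx hy (by simpa using h)

/-- A word of length at least two avoiding `2413` and `3142` is a direct sum or a skew sum. -/
theorem AvoidsOn.exists_splitAt (hab : a + 2 ≤ b) (hf : Set.InjOn f (Set.Ico a b))
    (h : AvoidsOn f a b) : ∃ d, a < d ∧ d < b ∧ SplitAt f a b d := by
  induction b, hab using Nat.le_induction with
  | base =>
    refine ⟨a + 1, by omega, by omega, ?_⟩
    have hne : f a ≠ f (a + 1) := fun h3 => by
      have := hf (show a ∈ Set.Ico a (a + 2) by simp) (by simp) h3
      omega
    rcases hne.lt_or_gt with h1 | h1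
    · refine Or.inl fun x y h2 h3 h4 h5 => ?_
      obtain rfl : x = a := by omega
      obtain rfl : y = x + 1 := by omega
      exact h1
    · refine Or.inr fun x y h2 h3 h4 h5 => ?_
      obtain rfl : x = a := by omega
      obtain rfl : y = x + 1 := by omega
      simpa using h1
  | succ b hab ih =>
    obtain ⟨c, hc1, hc2, hc⟩ := ih (hf.mono (Set.Ico_subset_Ico le_rfl (by omega)))
      (h.mono le_rfl (by omega))
    rcases hc with hc | hc
    · exact h.exists_splitAt_of_sumAt hf hc1 hc2 hc
    · obtain ⟨d, hd1, hd2, hd⟩ := h.neg.exists_splitAt_of_sumAt (injOn_neg hf) hc1 hc2 hc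
      exact ⟨d, hd1, hd2, by simpa using hd.neg⟩

/-! ### Rigidity of separable words -/

theorem SumAt.isBlock_left (h : SumAt f a b c) (hac : a < c) (hcb : c ≤ b) :
    IsBlock f a b a c := by
  refine ⟨le_rfl, hac, hcb, fun k x y h1 h2 h3 h4 h5 h6 h7 h8 h9 => ?_⟩
  have := h y k h6 h7 (by omega) h2
  omega

theorem SumAt.isBlock_right (h : SumAt f a b c) (hac : a ≤ c) (hcb : c < b) :
    IsBlock f a b c b := by
  refine ⟨hac, hcb, le_rfl, fun k x y h1 h2 h3 h4 h5 h6 h7 h8 h9 => ?_⟩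
  have := h k x h1 (by omega) (by omega) h5
  omega

theorem SplitAt.isBlock_left (h : SplitAt f a b c) (hac : a < c) (hcb : c ≤ b) :
    IsBlock f a b a c :=
  h.elim (fun h => h.isBlock_left hac hcb) fun h => isBlock_neg.1 (h.isBlock_left hac hcb)

theorem SplitAt.isBlock_right (h : SplitAt f a b c) (hac : a ≤ c) (hcb : c < b) :
    IsBlock f a b c b :=
  h.elim (fun h => h.isBlock_right hac hcb) fun h => isBlock_neg.1 (h.isBlock_right hac hcb)

/-- Intervals of an interval are intervals. -/
theorem IsBlock.trans (h : IsBlock f a b i j) (h' : IsBlock f i j p q) : IsBlock f a b p q := by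
  obtain ⟨h1, h2, h3, h4⟩ := h
  obtain ⟨k1, k2, k3, k4⟩ := h'
  refine ⟨by omega, k2, by omega, fun k x y l1 l2 l3 l4 l5 l6 l7 => ?_⟩
  by_cases hk : k < i ∨ j ≤ k
  · exact h4 k x y l1 l2 hk (by omega) (by omega) (by omega) (by omega)
  · exact k4 k x y (by omega) (by omega) l3 l4 l5 l6 l7

theorem IsBlock.restrict (h : IsBlock f a b p q) (hi : a ≤ i) (hip : i ≤ p) (hj : j ≤ b)
    (hqj : q ≤ j) : IsBlock f i j p q := by
  obtain ⟨h1, h2, h3, h4⟩ := h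
  exact ⟨hip, h2, hqj, fun k x y l1 l2 l3 => h4 k x y (by omega) (by omega) l3⟩

theorem SameBlocks.restrict (h : SameBlocks f g a b) (hf : IsBlock f a b i j) :
    SameBlocks f g i j := by
  have key : ∀ {f g : ℕ → ℤ}, SameBlocks f g a b → IsBlock f a b i j →
      ∀ p q, IsBlock f i j p q → IsBlock g i j p q := by
    intro f g h hf p q hpq
    exact ((h p q).1 (hf.trans hpq)).restrict hf.1 hpq.1 hf.2.2.1 hpq.2.2.1
  exact fun p q => ⟨key h hf p q, key h.symm ((h i j).1 hf) p q⟩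

/-- Two words that are direct sums at `c` with the same intervals cannot have opposite left
parts. -/
theorem SumAt.not_left_opposite (hf : SumAt f a b c) (hg : SumAt g a b c) (h : SameBlocks f g a b)
    {d : ℕ} (hd : SumAt f a c d) (had : a < d) (hdc : d < c) (hcb : c < b)
    (hop : SumAt (-g) a c d) : False := by
  -- The word `f` also splits at `d`, so `[d, b)` is a block of both words; but in `g` the letter at
  -- `a` lies strictly between those at `d` and `c`.
  have h1 : SumAt f a b d := fun x y h1 h2 h3 h4 => by
    rcases lt_or_ge y c with h5 | h5
    · exact hd x y h1 h2 h3 h5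
    · exact hf x y h1 (by omega) h5 h4
  have h2 := (h d b).1 (h1.isBlock_right had.le (by omega))
  have h3 := hop a d le_rfl had le_rfl hdc
  simp only [Pi.neg_apply] at h3
  exact h2.2.2.2 a d c le_rfl (by omega) (by omega) le_rfl (by omega) (by omega) hcb (by omega)
    (hg a c le_rfl (by omega) le_rfl hcb)

/-- Mirror image: `[a, d)` would be a block of `g`, although the letter at `d` lies strictly between
those at `a` and `c`. -/
theorem SumAt.not_right_opposite (hf : SumAt f a b c) (hg : SumAt g a b c)
    (h : SameBlocks f g a b) {d : ℕ} (hd : SumAt f c b d) (hac : a < c) (hcd : c < d) (hdb : d < b)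
    (hop : SumAt (-g) c b d) : False := by
  have h1 : SumAt f a b d := fun x y h1 h2 h3 h4 => by
    rcases lt_or_ge x c with h5 | h5
    · exact hf x y h1 h5 (by omega) h4
    · exact hd x y h5 h2 h3 h4
  have h2 := (h a d).1 (h1.isBlock_left (by omega) (by omega))
  have h3 := hop c d le_rfl hcd le_rfl hdb
  simp only [Pi.neg_apply] at h3
  exact h2.2.2.2 d a c (by omega) (by omega) (by omega) le_rfl (by omega) (by omega) (by omega)
    (hg a d le_rfl hac (by omega) hdb) (by omega)

theorem SumAt.sameOrder (hf : SumAt f a b c) (hg : SumAt g a b c) (h1 : SameOrder f g a c)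
    (h2 : SameOrder f g c b) : SameOrder f g a b := by
  intro x y hx hx' hy hy'
  rcases lt_or_ge x c with hxc | hxc <;> rcases lt_or_ge y c with hyc | hyc
  · exact h1 x y hx hxc hy hyc
  · exact iff_of_true (hf x y hx hxc hyc hy') (hg x y hx hxc hyc hy')
  · have e1 := hf y x hy hyc hxc hx'
    have e2 := hg y x hy hyc hxc hx'
    omega
  · exact h2 x y hxc hx' hyc hy'

theorem sameOrder_of_le_one (h : b ≤ a + 1) : SameOrder f g a b := by
  intro x y h1 h2 h3 h4
  obtain rfl : x = y := by omega
  simp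

/-- A word partitioned into the two blocks `[a, c)` and `[c, b)` is their direct or skew sum. -/
theorem splitAt_of_isBlock (hg : Set.InjOn g (Set.Ico a b)) (hac : a < c) (hcb : c < b)
    (h1 : IsBlock g a b a c) (h2 : IsBlock g a b c b) : SplitAt g a b c := by
  have hne : ∀ x y, a ≤ x → x < c → c ≤ y → y < b → g x ≠ g y := fun x y k1 k2 k3 k4 k5 => by
    have := hg (show x ∈ Set.Ico a b from ⟨k1, by omega⟩) ⟨by omega, k4⟩ k5
    omega
  -- The comparison of positions `a` and `c` decides the sign: the left block lets `a` be replaced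
  -- by any `x`, then the right block lets `c` be replaced by any `y`.
  rcases (hne a c le_rfl hac le_rfl hcb).lt_or_gt with h | h
  · refine Or.inl fun x y k1 k2 k3 k4 => ?_
    have e1 := h1.2.2.2 c a x (by omega) hcb (by omega) le_rfl hac k1 k2 h
    have e2 := h2.2.2.2 x y c k1 (by omega) (by omega) k3 k4 le_rfl hcb
    have := hne x y k1 k2 k3 k4
    have := hne x c k1 k2 le_rfl hcb
    omega
  · refine Or.inr fun x y k1 k2 k3 k4 => ?_
    have e1 := h1.2.2.2 c x a (by omega) hcb (by omega) k1 k2 le_rfl hac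
    have e2 := h2.2.2.2 x c y k1 (by omega) (by omega) le_rfl hcb k3 k4
    have := hne x y k1 k2 k3 k4
    have := hne x c k1 k2 le_rfl hcb
    simp only [Pi.neg_apply]
    omega

/-- A word avoiding `2413` and `3142` is determined by its intervals up to reversing the order of
the values. -/
theorem AvoidsOn.rigid (hf : Set.InjOn f (Set.Ico a b)) (hg : Set.InjOn g (Set.Ico a b))
    (h : AvoidsOn f a b) (hfg : SameBlocks f g a b) : SameOrder f g a b ∨ SameOrder f (-g) a b := by
  induction hm : b - a using Nat.strong_induction_on generalizing a b f g with
  | _ m ih =>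
  subst hm
  rcases le_or_gt b (a + 1) with hab | hab
  · exact Or.inl (sameOrder_of_le_one hab)
  obtain ⟨c, hac, hcb, hc⟩ := h.exists_splitAt hab hf
  have main : ∀ {f g : ℕ → ℤ}, Set.InjOn f (Set.Ico a b) → Set.InjOn g (Set.Ico a b) →
      AvoidsOn f a b → SameBlocks f g a b → SumAt f a b c → SumAt g a b c →
      SameOrder f g a b := by
    intro f g hf hg h hfg hfc hgc
    have hL : Set.Ico a c ⊆ Set.Ico a b := Set.Ico_subset_Ico le_rfl hcb.le
    have hR : Set.Ico c b ⊆ Set.Ico a b := Set.Ico_subset_Ico hac.le le_rfl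
    refine hfc.sameOrder hgc ?_ ?_
    · rcases le_or_gt c (a + 1) with hac' | hac'
      · exact sameOrder_of_le_one hac'
      have hav : AvoidsOn f a c := h.mono le_rfl hcb.le
      refine (ih (c - a) (by omega) (hf.mono hL) (hg.mono hL) hav
        (hfg.restrict (hfc.isBlock_left hac hcb.le)) rfl).resolve_right fun hop => ?_
      obtain ⟨d, hd1, hd2, hd | hd⟩ := hav.exists_splitAt hac' (hf.mono hL)
      · exact hfc.not_left_opposite hgc hfg hd hd1 hd2 hcb (hd.congr hop hd1.le hd2.le)
      -- Here the left part of `f` is a skew sum, so that of `g` is a direct sum and the two words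
      -- exchange roles.
      · refine hgc.not_left_opposite hfc hfg.symm (d := d) ?_ hd1 hd2 hcb hd
        simpa using hd.congr hop.neg hd1.le hd2.le
    · rcases le_or_gt b (c + 1) with hac' | hac'
      · exact sameOrder_of_le_one hac'
      have hav : AvoidsOn f c b := h.mono hac.le le_rfl
      refine (ih (b - c) (by omega) (hf.mono hR) (hg.mono hR) hav
        (hfg.restrict (hfc.isBlock_right hac.le hcb)) rfl).resolve_right fun hop => ?_
      obtain ⟨d, hd1, hd2, hd | hd⟩ := hav.exists_splitAt hac' (hf.mono hR)
      · exact hfc.not_right_opposite hgc hfg hd hac hd1 hd2 (hd.congr hop hd1.le hd2.le)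
      · refine hgc.not_right_opposite hfc hfg.symm (d := d) ?_ hac hd1 hd2 hd
        simpa using hd.congr hop.neg hd1.le hd2.le
  -- Being blocks, both parts of `f` are blocks of `g`, so `g` splits at `c` too; negations then
  -- reduce every sign pattern to `main`.
  have hgc : SplitAt g a b c := splitAt_of_isBlock hg hac hcb
    ((hfg a c).1 (hc.isBlock_left hac hcb.le)) ((hfg c b).1 (hc.isBlock_right hac.le hcb))
  rcases hc with hc | hc <;> rcases hgc with hgc | hgc
  · exact Or.inl (main hf hg h hfg hc hgc)
  · exact Or.inr (main hf (injOn_neg hg) h (sameBlocks_neg_right.2 hfg) hc hgc)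
  · refine Or.inr ?_
    simpa using (main (injOn_neg hf) hg h.neg (sameBlocks_neg_left.2 hfg) hc hgc).neg
  · refine Or.inl ?_
    simpa using (main (injOn_neg hf) (injOn_neg hg) h.neg
      (sameBlocks_neg_left.2 (sameBlocks_neg_right.2 hfg)) hc hgc).neg

/-! ### Flips and crossing blocks -/

/-- `g` is obtained from `f` by reversing the order of the values at the positions
`i, …, j - 1`. -/
structure IsFlip (f g : ℕ → ℤ) (a b i j : ℕ) : Prop where
  inside : ∀ x y, i ≤ x → x < j → i ≤ y → y < j → (f x < f y ↔ g y < g x)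
  outside : ∀ x y, a ≤ x → x < b → a ≤ y → y < b →
    (x < i ∨ j ≤ x ∨ y < i ∨ j ≤ y) → (f x < f y ↔ g x < g y)

theorem IsFlip.symm (h : IsFlip f g a b i j) : IsFlip g f a b i j :=
  ⟨fun x y h1 h2 h3 h4 => (h.inside y x h3 h4 h1 h2).symm,
    fun x y h1 h2 h3 h4 h5 => (h.outside x y h1 h2 h3 h4 h5).symm⟩

theorem IsFlip.sameOrder_neg (h : IsFlip f g a b i j) : SameOrder f (-g) i j :=
  fun x y h1 h2 h3 h4 => by simpa using h.inside x y h1 h2 h3 h4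

theorem IsFlip.isBlock_of_subset (h : IsFlip f g a b i j) (hb : IsBlock f a b p q)
    (hi : i ≤ p) (hj : q ≤ j) : IsBlock g a b p q := by
  obtain ⟨h1, h2, h3, h4⟩ := hb
  refine ⟨h1, h2, h3, fun k x y l1 l2 l3 l4 l5 l6 l7 l8 l9 => ?_⟩
  by_cases hk : k < i ∨ j ≤ k
  · exact h4 k x y l1 l2 l3 l4 l5 l6 l7
      ((h.outside x k (by omega) (by omega) l1 l2 (by omega)).2 l8)
      ((h.outside k y l1 l2 (by omega) (by omega) (by omega)).2 l9)
  · exact h4 k y x l1 l2 l3 l6 l7 l4 l5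
      ((h.inside y k (by omega) (by omega) (by omega) (by omega)).2 l9)
      ((h.inside k x (by omega) (by omega) (by omega) (by omega)).2 l8)

theorem IsFlip.isBlock_of_superset (h : IsFlip f g a b i j) (hb : IsBlock f a b p q)
    (hi : p ≤ i) (hj : j ≤ q) : IsBlock g a b p q := by
  obtain ⟨h1, h2, h3, h4⟩ := hb
  exact ⟨h1, h2, h3, fun k x y l1 l2 l3 l4 l5 l6 l7 l8 l9 => h4 k x y l1 l2 l3 l4 l5 l6 l7
      ((h.outside x k (by omega) (by omega) l1 l2 (by omega)).2 l8)
      ((h.outside k y l1 l2 (by omega) (by omega) (by omega)).2 l9)⟩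

theorem IsFlip.isBlock_of_disjoint (h : IsFlip f g a b i j) (hb : IsBlock f a b p q)
    (hd : q ≤ i ∨ j ≤ p) : IsBlock g a b p q := by
  obtain ⟨h1, h2, h3, h4⟩ := hb
  exact ⟨h1, h2, h3, fun k x y l1 l2 l3 l4 l5 l6 l7 l8 l9 => h4 k x y l1 l2 l3 l4 l5 l6 l7
      ((h.outside x k (by omega) (by omega) l1 l2 (by omega)).2 l8)
      ((h.outside k y l1 l2 (by omega) (by omega) (by omega)).2 l9)⟩

/-- The block `[p, q)` crosses `[i, j)`. -/
def Crosses (p q i j : ℕ) : Prop :=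
  p < i ∧ i < q ∧ q < j ∨ i < p ∧ p < j ∧ j < q

/-- A block that does not cross `[i, j)` lies inside it, contains it or is disjoint from it. Then
the comparisons of any outside letter with the letters of the block are all kept or all reversed. -/
theorem IsFlip.sameBlocks (h : IsFlip f g a b i j)
    (hf : ∀ p q, IsBlock f a b p q → ¬ Crosses p q i j)
    (hg : ∀ p q, IsBlock g a b p q → ¬ Crosses p q i j) : SameBlocks f g a b := by
  have key : ∀ {f g : ℕ → ℤ}, IsFlip f g a b i j →
      (∀ p q, IsBlock f a b p q → ¬ Crosses p q i j) →
      ∀ p q, IsBlock f a b p q → IsBlock g a b p q := by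
    intro f g h hf p q hb
    have hc := hf p q hb
    have := hb.2.1
    unfold Crosses at hc
    by_cases h1 : i ≤ p ∧ q ≤ j
    · exact h.isBlock_of_subset hb h1.1 h1.2
    by_cases h2 : p ≤ i ∧ j ≤ q
    · exact h.isBlock_of_superset hb h2.1 h2.2
    exact h.isBlock_of_disjoint hb (by omega)
  exact fun p q => ⟨key h hf p q, key h.symm hg p q⟩

theorem Set.InjOn.word_ne (hf : Set.InjOn f (Set.Ico a b)) {x y : ℕ} (hxy : x ≠ y) (hx : a ≤ x)
    (hx' : x < b) (hy : a ≤ y) (hy' : y < b) : f x ≠ f y :=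
  fun h => hxy (hf ⟨hx, hx'⟩ ⟨hy, hy'⟩ h)

/-- Position `i` lies in both blocks. A letter strictly between two letters of the union would be
strictly between `f i` and one of them, hence inside the range of a single block. -/
theorem IsBlock.union (hf : Set.InjOn f (Set.Ico a b)) (h1 : IsBlock f a b p q)
    (h2 : IsBlock f a b i j) (hpi : p < i) (hiq : i < q) (hqj : q < j) : IsBlock f a b p j := by
  obtain ⟨k1, k2, k3, k4⟩ := h1
  obtain ⟨l1, l2, l3, l4⟩ := h2
  refine ⟨k1, by omega, l3, fun k x y m1 m2 m3 m4 m5 m6 m7 m8 m9 => ?_⟩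
  have e1 : ∀ u v, p ≤ u → u < q → p ≤ v → v < q → f u < f k → ¬ f k < f v :=
    fun u v => k4 k u v m1 m2 (by omega)
  have e2 : ∀ u v, i ≤ u → u < j → i ≤ v → v < j → f u < f k → ¬ f k < f v :=
    fun u v => l4 k u v m1 m2 (by omega)
  rcases (hf.word_ne (show i ≠ k by omega) l1 (by omega) m1 m2).lt_or_gt with h | h
  · rcases lt_or_ge y q with hy | hy
    · exact e1 i y (by omega) hiq m6 hy h m9
    · exact e2 i y le_rfl (by omega) (by omega) m7 h m9
  · rcases lt_or_ge x q with hx | hx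
    · exact e1 x i m4 hx (by omega) hiq m8 h
    · exact e2 x i (by omega) m5 le_rfl (by omega) m8 h

/-- The union of two crossing blocks splits at both boundaries. -/
theorem IsBlock.splitAt_of_crossing (hf : Set.InjOn f (Set.Ico a b)) (h1 : IsBlock f a b p q)
    (h2 : IsBlock f a b i j) (hpi : p < i) (hiq : i < q) (hqj : q < j) :
    SplitAt f p j i ∧ SplitAt f p j q := by
  have h1' := h1
  have h2' := h2
  obtain ⟨k1, k2, k3, k4⟩ := h1'
  obtain ⟨l1, l2, l3, l4⟩ := h2'
  have hf' : Set.InjOn f (Set.Ico p j) := hf.mono (Set.Ico_subset_Ico k1 l3)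
  constructor
  · refine splitAt_of_isBlock hf' hpi (by omega) ?_
      (h2.restrict k1 hpi.le l3 le_rfl)
    refine ⟨le_rfl, hpi, by omega, fun k x y m1 m2 m3 m4 m5 m6 m7 m8 m9 => ?_⟩
    -- Position `q` is the reference: `x` and `y` each have `k` and `q` on the same side by the
    -- second block, and `q` does not lie between them by the first.
    have e1 := l4 x q k (by omega) (by omega) (by omega) (by omega) hqj (by omega) m2
    have e2 := l4 y k q (by omega) (by omega) (by omega) (by omega) m2 (by omega) hqj
    have e3 := k4 q x y (by omega) (by omega) (by omega) m4 (by omega) m6 (by omega)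
    have := hf'.word_ne (show x ≠ q by omega) m4 (by omega) (by omega) hqj
    have := hf'.word_ne (show y ≠ q by omega) m6 (by omega) (by omega) hqj
    omega
  · refine splitAt_of_isBlock hf' k2 hqj (h1.restrict k1 le_rfl l3 hqj.le) ?_
    refine ⟨by omega, hqj, le_rfl, fun k x y m1 m2 m3 m4 m5 m6 m7 m8 m9 => ?_⟩
    have e1 := k4 x p k (by omega) (by omega) (by omega) (by omega) k2 (by omega) (by omega)
    have e2 := k4 y k p (by omega) (by omega) (by omega) (by omega) (by omega) (by omega) k2
    have e3 := l4 p x y (by omega) (by omega) (by omega) (by omega) m5 (by omega) (by omega)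
    have := hf'.word_ne (show x ≠ p by omega) (by omega) m5 (by omega) (by omega)
    have := hf'.word_ne (show y ≠ p by omega) (by omega) m7 (by omega) (by omega)
    omega

/-- The word `f` on `[a, b)` is neither a direct sum nor a skew sum. -/
def Indecomposable (f : ℕ → ℤ) (a b : ℕ) : Prop :=
  ∀ c, a < c → c < b → ¬ SplitAt f a b c

theorem Indecomposable.congr (h : Indecomposable f a b) (hfg : SameOrder f g a b) :
    Indecomposable g a b :=
  fun c h1 h2 h3 => h c h1 h2 (h3.congr hfg.symm h1.le h2.le)

theorem Indecomposable.neg (h : Indecomposable f a b) : Indecomposable (-f) a b :=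
  fun c h1 h2 h3 => h c h1 h2 (by simpa using h3.neg)

/-- A crossing block makes the union split at a point interior to `[i, j)`, and that split restricts
to `[i, j)`. -/
theorem Indecomposable.not_crosses (hf : Set.InjOn f (Set.Ico a b)) (h : Indecomposable f i j)
    (hb : IsBlock f a b i j) (hpq : IsBlock f a b p q) : ¬ Crosses p q i j := by
  rintro (⟨h1, h2, h3⟩ | ⟨h1, h2, h3⟩)
  · exact h q h2 h3 ((hpq.splitAt_of_crossing hf hb h1 h2 h3).2.mono h1.le le_rfl)
  · exact h p h1 h2 ((hb.splitAt_of_crossing hf hpq h1 h2 h3).1.mono le_rfl h3.le)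

/-- The union of `[i, j)` with a crossing block of `g` is also a block of `f`, hence everything by
maximality. What remains outside `[i, j)` is a block of `g` disjoint from the flip, hence a block of
`f`, so `f` would split. -/
theorem IsFlip.not_crosses_of_maximal (h : IsFlip f g a b i j) (hf : Set.InjOn f (Set.Ico a b))
    (hg : Set.InjOn g (Set.Ico a b)) (hind : Indecomposable f a b) (hb : IsBlock f a b i j)
    (hmax : ∀ p q, IsBlock f a b p q → p ≤ i → j ≤ q → j - i < q - p → p = a ∧ q = b)
    (hpq : IsBlock g a b p q) : ¬ Crosses p q i j := by
  have hgb := h.isBlock_of_subset hb le_rfl le_rfl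
  rintro (⟨h1, h2, h3⟩ | ⟨h1, h2, h3⟩)
  · obtain ⟨rfl, rfl⟩ := hmax p j (h.symm.isBlock_of_superset (hpq.union hg hgb h1 h2 h3) h1.le
      le_rfl) h1.le le_rfl (by omega)
    exact hind i h1 (by omega) (splitAt_of_isBlock hf h1 (by omega) (h.symm.isBlock_of_disjoint
      ((hpq.splitAt_of_crossing hg hgb h1 h2 h3).1.isBlock_left h1 (by omega)) (by omega)) hb)
  · obtain ⟨rfl, rfl⟩ := hmax i q (h.symm.isBlock_of_superset (hgb.union hg hpq h1 h2 h3) le_rfl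
      h3.le) le_rfl h3.le (by omega)
    exact hind j (by omega) h3 (splitAt_of_isBlock hf (by omega) h3 hb (h.symm.isBlock_of_disjoint
      ((hgb.splitAt_of_crossing hg hpq h1 h2 h3).2.isBlock_right (by omega) h3) (by omega)))

theorem Indecomposable.not_crosses_of_maximal (hf : Set.InjOn f (Set.Ico a b))
    (hind : Indecomposable f a b) (hb : IsBlock f a b i j)
    (hmax : ∀ p q, IsBlock f a b p q → p ≤ i → j ≤ q → j - i < q - p → p = a ∧ q = b)
    (hpq : IsBlock f a b p q) : ¬ Crosses p q i j := by
  rintro (⟨h1, h2, h3⟩ | ⟨h1, h2, h3⟩)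
  · obtain ⟨rfl, rfl⟩ := hmax p j (hpq.union hf hb h1 h2 h3) h1.le le_rfl (by omega)
    exact hind i h1 (by omega) (hpq.splitAt_of_crossing hf hb h1 h2 h3).1
  · obtain ⟨rfl, rfl⟩ := hmax i q (hb.union hf hpq h1 h2 h3) le_rfl h3.le (by omega)
    exact hind p h1 (by omega) (hb.splitAt_of_crossing hf hpq h1 h2 h3).1

theorem exists_isFlip (hf : Set.InjOn f (Set.Ico a b)) (hb : IsBlock f a b i j) :
    ∃ g, IsFlip f g a b i j ∧ Set.InjOn g (Set.Ico a b) := by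
  have hb' := hb
  obtain ⟨h1, h2, h3, h4⟩ := hb'
  have hne : (Finset.Ico i j).Nonempty := Finset.nonempty_Ico.2 h2
  obtain ⟨u, hu, hu'⟩ := Finset.exists_min_image _ f hne
  obtain ⟨v, hv, hv'⟩ := Finset.exists_max_image _ f hne
  rw [Finset.mem_Ico] at hu hv
  -- Reflecting in the minimum and maximum keeps the values in the same range, which no letter
  -- outside the block enters.
  let g : ℕ → ℤ := fun k => if i ≤ k ∧ k < j then f u + f v - f k else f k
  have gin : ∀ k, i ≤ k → k < j → g k = f u + f v - f k := fun k h h' => if_pos ⟨h, h'⟩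
  have gout : ∀ k, k < i ∨ j ≤ k → g k = f k := fun k h => if_neg (by omega)
  have hmin : ∀ k, i ≤ k → k < j → f u ≤ f k ∧ f k ≤ f v := fun k h h' =>
    ⟨hu' k (Finset.mem_Ico.2 ⟨h, h'⟩), hv' k (Finset.mem_Ico.2 ⟨h, h'⟩)⟩
  have hout : ∀ k, a ≤ k → k < b → k < i ∨ j ≤ k → f k < f u ∨ f v < f k := fun k k1 k2 k3 => by
    have := h4 k u v k1 k2 k3 hu.1 hu.2 hv.1 hv.2
    have := hf.word_ne (show k ≠ u by omega) k1 k2 (by omega) (by omega)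
    have := hf.word_ne (show k ≠ v by omega) k1 k2 (by omega) (by omega)
    omega
  have hflip : IsFlip f g a b i j := by
    constructor
    · intro x y k1 k2 k3 k4
      rw [gin x k1 k2, gin y k3 k4]
      omega
    · intro x y k1 k2 k3 k4 k5
      by_cases hx : x < i ∨ j ≤ x <;> by_cases hy : y < i ∨ j ≤ y
      · rw [gout x hx, gout y hy]
      · have := hout x k1 k2 hx
        have := hmin y (by omega) (by omega)
        rw [gout x hx, gin y (by omega) (by omega)]
        omega
      · have := hout y k3 k4 hy
        have := hmin x (by omega) (by omega)
        rw [gout y hy, gin x (by omega) (by omega)]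
        omega
      · omega
  refine ⟨g, hflip, fun x hx y hy hxy => ?_⟩
  by_contra hne
  have := hf.word_ne hne hx.1 hx.2 hy.1 hy.2
  by_cases hc : x < i ∨ j ≤ x ∨ y < i ∨ j ≤ y
  · have := hflip.outside x y hx.1 hx.2 hy.1 hy.2 hc
    have := hflip.outside y x hy.1 hy.2 hx.1 hx.2 (by omega)
    omega
  · have := hflip.inside x y (by omega) (by omega) (by omega) (by omega)
    have := hflip.inside y x (by omega) (by omega) (by omega) (by omega)
    omega

/-- The flip of a nontrivial proper block differs from the word and its reversal. -/
theorem IsFlip.not_sameOrder (h : IsFlip f g a b i j) (hf : Set.InjOn f (Set.Ico a b))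
    (hai : a ≤ i) (hij : i + 2 ≤ j) (hjb : j ≤ b) (hlt : j - i < b - a) :
    ¬ SameOrder f g a b ∧ ¬ SameOrder f (-g) a b := by
  constructor
  · intro hs
    have := hf.word_ne (show i ≠ i + 1 by omega) hai (by omega) (by omega) (by omega)
    have := h.inside i (i + 1) (by omega) (by omega) (by omega) (by omega)
    have := h.inside (i + 1) i (by omega) (by omega) (by omega) (by omega)
    have := hs i (i + 1) (by omega) (by omega) (by omega) (by omega)
    have := hs (i + 1) i (by omega) (by omega) (by omega) (by omega)
    omega
  · intro hs
    obtain ⟨k, hk1, hk2, hk3⟩ : ∃ k, a ≤ k ∧ k < b ∧ (k < i ∨ j ≤ k) := by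
      rcases hai.eq_or_lt with rfl | h
      · exact ⟨j, by omega, by omega, by omega⟩
      · exact ⟨a, by omega, by omega, by omega⟩
    have := hf.word_ne (show i ≠ k by omega) hai (by omega) hk1 hk2
    have := h.outside i k (by omega) (by omega) (by omega) (by omega) (by omega)
    have := h.outside k i (by omega) (by omega) (by omega) (by omega) (by omega)
    have := hs i k (by omega) (by omega) (by omega) (by omega)
    have := hs k i (by omega) (by omega) (by omega) (by omega)
    simp only [Pi.neg_apply] at *
    omega

/-! ### Existence of a third word -/

/-- Some word with the same intervals as `f` is neither `f` nor its reversal, up to order. -/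
def HasThird (f : ℕ → ℤ) (a b : ℕ) : Prop :=
  ∃ g, Set.InjOn g (Set.Ico a b) ∧ SameBlocks f g a b ∧
    ¬ SameOrder f g a b ∧ ¬ SameOrder f (-g) a b

theorem HasThird.of_indecomposable_block (hf : Set.InjOn f (Set.Ico a b)) (hb : IsBlock f a b i j)
    (hind : Indecomposable f i j) (hij : i + 2 ≤ j) (hlt : j - i < b - a) : HasThird f a b := by
  obtain ⟨g, hg, hgi⟩ := exists_isFlip hf hb
  refine ⟨g, hgi, hg.sameBlocks (fun p q hpq => hind.not_crosses hf hb hpq) (fun p q hpq => ?_),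
    hg.not_sameOrder hf hb.1 hij hb.2.2.1 hlt⟩
  refine Indecomposable.not_crosses hgi ?_ (hg.isBlock_of_subset hb le_rfl le_rfl) hpq
  simpa using (hind.congr hg.sameOrder_neg).neg

/-- The block may itself split, so crossings are excluded by its maximality and the
indecomposability of the whole word. -/
theorem HasThird.of_maximal_block (hf : Set.InjOn f (Set.Ico a b)) (hb : IsBlock f a b i j)
    (hind : Indecomposable f a b) (hij : i + 2 ≤ j) (hlt : j - i < b - a)
    (hmax : ∀ p q, IsBlock f a b p q → p ≤ i → j ≤ q → j - i < q - p → p = a ∧ q = b) :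
    HasThird f a b := by
  obtain ⟨g, hg, hgi⟩ := exists_isFlip hf hb
  exact ⟨g, hgi, hg.sameBlocks
    (fun p q hpq => hind.not_crosses_of_maximal hf hb hmax hpq)
    (fun p q hpq => hg.not_crosses_of_maximal hf hgi hind hb hmax hpq),
    hg.not_sameOrder hf hb.1 hij hb.2.2.1 hlt⟩

/-- Every nontrivial block of `f` is everything. -/
def IsSimpleWord (f : ℕ → ℤ) (n : ℕ) : Prop :=
  ∀ i j, IsBlock f 0 n i j → i + 2 ≤ j → i = 0 ∧ j = n

theorem isBlock_singleton (hn : i < n) : IsBlock f 0 n i (i + 1) := by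
  refine ⟨by omega, by omega, by omega, fun k x y h1 h2 h3 h4 h5 h6 h7 h8 h9 => ?_⟩
  obtain rfl : x = y := by omega
  omega

theorem isBlock_univ (hn : 0 < n) : IsBlock f 0 n 0 n :=
  ⟨le_rfl, hn, le_rfl, fun k x y h1 h2 h3 => by omega⟩

theorem IsSimpleWord.sameBlocks (hf : IsSimpleWord f n) (hg : IsSimpleWord g n) :
    SameBlocks f g 0 n := by
  have key : ∀ {f g : ℕ → ℤ}, IsSimpleWord f n → ∀ i j, IsBlock f 0 n i j → IsBlock g 0 n i j := by
    intro f g hf i j hb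
    have := hb.2.1
    have := hb.2.2.1
    by_cases h : i + 2 ≤ j
    · obtain ⟨rfl, rfl⟩ := hf i j hb h
      exact isBlock_univ (by omega)
    · obtain rfl : j = i + 1 := by omega
      exact isBlock_singleton (by omega)
  exact fun i j => ⟨key hf i j, key hg i j⟩

/-- The oscillation `2 4 1 6 3 8 5 …`. -/
def zigzag (n : ℕ) (i : ℕ) : ℤ :=
  -- The exceptional value at an odd last position keeps it from being the maximum, which would
  -- split off. Values need only be distinct, not consecutive.
  if i = 0 then 1 else if i % 2 = 0 then i - 2 else if i + 1 = n then i - 1 else i + 2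

/-- The oscillation `3 1 5 2 7 4 …`. -/
def zigzag' (n : ℕ) (i : ℕ) : ℤ :=
  if i % 2 = 1 then i - 1 else if i + 1 = n then i else i + 3

theorem zigzag_spec (n i : ℕ) : i = 0 ∧ zigzag n i = 1 ∨ 0 < i ∧ i % 2 = 0 ∧ zigzag n i = i - 2 ∨
    i % 2 = 1 ∧ i + 1 = n ∧ zigzag n i = i - 1 ∨ i % 2 = 1 ∧ i + 1 ≠ n ∧ zigzag n i = i + 2 := by
  unfold zigzag
  split_ifs <;> omega

theorem zigzag'_spec (n i : ℕ) : i % 2 = 1 ∧ zigzag' n i = i - 1 ∨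
    i % 2 = 0 ∧ i + 1 = n ∧ zigzag' n i = i ∨ i % 2 = 0 ∧ i + 1 ≠ n ∧ zigzag' n i = i + 3 := by
  unfold zigzag'
  split_ifs <;> omega

theorem zigzag_injOn : Set.InjOn (zigzag n) (Set.Ico 0 n) := by
  intro x hx y hy h
  simp only [Set.mem_Ico, zigzag] at *
  split_ifs at h <;> omega

theorem zigzag'_injOn : Set.InjOn (zigzag' n) (Set.Ico 0 n) := by
  intro x hx y hy h
  simp only [Set.mem_Ico, zigzag'] at *
  split_ifs at h <;> omega

theorem IsBlock.not_between (h : IsBlock f 0 n i j) (k x y : ℕ) (hk : k < n) (hk' : k < i ∨ j ≤ k)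
    (hx : i ≤ x ∧ x < j) (hy : i ≤ y ∧ y < j) (h1 : f x < f k) (h2 : f k < f y) : False :=
  h.2.2.2 k x y k.zero_le hk hk' hx.1 hx.2 hy.1 hy.2 h1 h2

/-- For each proper range of at least two positions, a letter near it lies strictly between two of
its letters: on the right for prefixes, on the left otherwise. -/
theorem isSimpleWord_zigzag (hn : 5 ≤ n) : IsSimpleWord (zigzag n) n := by
  intro i j hb hij
  have hjn := hb.2.2.1
  have key := hb.not_between
  by_contra hne
  rcases Nat.eq_zero_or_pos i with rfl | hi
  · rcases Nat.lt_or_ge j 4 with hj | hj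
    · have := zigzag_spec n 4
      have := zigzag_spec n 0
      have := zigzag_spec n 1
      exact key 4 0 1 (by omega) (by omega) (by omega)
        (by omega) (by omega) (by omega)
    rcases Nat.even_or_odd' j with ⟨m, rfl | rfl⟩
    · have := zigzag_spec n (2 * m)
      have := zigzag_spec n (2 * m - 2)
      have := zigzag_spec n (2 * m - 1)
      exact key (2 * m) (2 * m - 2) (2 * m - 1) (by omega) (by omega) (by omega)
        (by omega) (by omega) (by omega)
    · by_cases h : 2 * m + 2 = n
      · have := zigzag_spec n (2 * m + 1)
        have := zigzag_spec n (2 * m)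
        have := zigzag_spec n (2 * m - 1)
        exact key (2 * m + 1) (2 * m) (2 * m - 1) (by omega) (by omega) (by omega)
          (by omega) (by omega) (by omega)
      · have := zigzag_spec n (2 * m + 2)
        have := zigzag_spec n (2 * m)
        have := zigzag_spec n (2 * m - 1)
        exact key (2 * m + 2) (2 * m) (2 * m - 1) (by omega) (by omega) (by omega)
          (by omega) (by omega) (by omega)
  · rcases Nat.lt_or_ge i 3 with hi' | hi'
    · obtain rfl | rfl : i = 1 ∨ i = 2 := by omega
      · have := zigzag_spec n 0
        have := zigzag_spec n 2
        have := zigzag_spec n 1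
        exact key 0 2 1 (by omega) (by omega) (by omega)
          (by omega) (by omega) (by omega)
      · have := zigzag_spec n 0
        have := zigzag_spec n 2
        have := zigzag_spec n 3
        exact key 0 2 3 (by omega) (by omega) (by omega)
          (by omega) (by omega) (by omega)
    rcases Nat.even_or_odd' i with ⟨m, rfl | rfl⟩
    · have := zigzag_spec n (2 * m - 3)
      have := zigzag_spec n (2 * m)
      have := zigzag_spec n (2 * m + 1)
      exact key (2 * m - 3) (2 * m) (2 * m + 1) (by omega) (by omega) (by omega)
        (by omega) (by omega) (by omega)
    · have := zigzag_spec n (2 * m - 1)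
      have := zigzag_spec n (2 * m + 2)
      have := zigzag_spec n (2 * m + 1)
      exact key (2 * m - 1) (2 * m + 2) (2 * m + 1) (by omega) (by omega) (by omega)
        (by omega) (by omega) (by omega)

theorem isSimpleWord_zigzag' (hn : 5 ≤ n) : IsSimpleWord (zigzag' n) n := by
  intro i j hb hij
  have hjn := hb.2.2.1
  have key := hb.not_between
  by_contra hne
  rcases Nat.eq_zero_or_pos i with rfl | hi
  · rcases Nat.lt_or_ge j 3 with hj | hj
    · have := zigzag'_spec n 3
      have := zigzag'_spec n 1
      have := zigzag'_spec n 0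
      exact key 3 1 0 (by omega) (by omega) (by omega)
        (by omega) (by omega) (by omega)
    rcases Nat.even_or_odd' j with ⟨m, rfl | rfl⟩
    · by_cases h : 2 * m + 1 = n
      · have := zigzag'_spec n (2 * m)
        have := zigzag'_spec n (2 * m - 1)
        have := zigzag'_spec n (2 * m - 2)
        exact key (2 * m) (2 * m - 1) (2 * m - 2) (by omega) (by omega) (by omega)
          (by omega) (by omega) (by omega)
      · have := zigzag'_spec n (2 * m + 1)
        have := zigzag'_spec n (2 * m - 1)
        have := zigzag'_spec n (2 * m - 2)
        exact key (2 * m + 1) (2 * m - 1) (2 * m - 2) (by omega) (by omega) (by omega)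
          (by omega) (by omega) (by omega)
    · have := zigzag'_spec n (2 * m + 1)
      have := zigzag'_spec n (2 * m - 1)
      have := zigzag'_spec n (2 * m)
      exact key (2 * m + 1) (2 * m - 1) (2 * m) (by omega) (by omega) (by omega)
        (by omega) (by omega) (by omega)
  · rcases Nat.lt_or_ge i 2 with hi' | hi'
    · have := zigzag'_spec n 0
      have := zigzag'_spec n 1
      have := zigzag'_spec n 2
      exact key 0 1 2 (by omega) (by omega) (by omega)
        (by omega) (by omega) (by omega)
    rcases Nat.even_or_odd' i with ⟨m, rfl | rfl⟩
    · have := zigzag'_spec n (2 * m - 2)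
      have := zigzag'_spec n (2 * m + 1)
      have := zigzag'_spec n (2 * m)
      exact key (2 * m - 2) (2 * m + 1) (2 * m) (by omega) (by omega) (by omega)
        (by omega) (by omega) (by omega)
    · have := zigzag'_spec n (2 * m - 2)
      have := zigzag'_spec n (2 * m + 1)
      have := zigzag'_spec n (2 * m + 2)
      exact key (2 * m - 2) (2 * m + 1) (2 * m + 2) (by omega) (by omega) (by omega)
        (by omega) (by omega) (by omega)

theorem zigzag_not_sameOrder (hn : 5 ≤ n) :
    ¬ SameOrder (zigzag n) (zigzag' n) 0 n ∧ ¬ SameOrder (zigzag n) (-zigzag' n) 0 n := by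
  constructor
  · intro h
    have := h 0 1 le_rfl (by omega) (by omega) (by omega)
    simp only [zigzag, zigzag'] at this
    split_ifs at this <;> omega
  · intro h
    -- Positions 0 and 4 form an ascent in both words.
    have := h 0 4 le_rfl (by omega) (by omega) (by omega)
    simp only [zigzag, zigzag', Pi.neg_apply] at this
    split_ifs at this <;> omega

/-- The word `zigzag n` is a third one unless `f` is it up to reversal, and then `zigzag' n` serves.
-/
theorem HasThird.of_isSimpleWord (hn : 5 ≤ n) (hf : IsSimpleWord f n) : HasThird f 0 n := by
  by_cases h : SameOrder f (zigzag n) 0 n ∨ SameOrder f (-zigzag n) 0 n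
  · refine ⟨zigzag' n, zigzag'_injOn, hf.sameBlocks (isSimpleWord_zigzag' hn), fun h' => ?_,
      fun h' => ?_⟩
    · rcases h with h | h
      · exact (zigzag_not_sameOrder hn).1 (h.symm.trans h')
      · exact (zigzag_not_sameOrder hn).2 (by simpa using (h.symm.trans h').neg)
    · rcases h with h | h
      · exact (zigzag_not_sameOrder hn).2 (h.symm.trans h')
      · exact (zigzag_not_sameOrder hn).1 (by simpa using (h.symm.trans h').neg)
  · rw [not_or] at h
    exact ⟨zigzag n, zigzag_injOn, hf.sameBlocks (isSimpleWord_zigzag hn), h.1, h.2⟩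

theorem exists_minimal_not_avoidsOn (hn : 0 < n) (h : ¬ AvoidsOn f 0 n) :
    ∃ i j, IsBlock f 0 n i j ∧ ¬ AvoidsOn f i j ∧
      ∀ p q, IsBlock f 0 n p q → q - p < j - i → AvoidsOn f p q := by
  classical
  have hex : ∃ d i j, IsBlock f 0 n i j ∧ ¬ AvoidsOn f i j ∧ j - i = d :=
    ⟨n, 0, n, isBlock_univ hn, h, rfl⟩
  obtain ⟨i, j, hb, hav, hd⟩ := Nat.find_spec hex
  refine ⟨i, j, hb, hav, fun p q hpq hlt => ?_⟩
  by_contra hcon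
  exact Nat.find_min hex (hlt.trans_eq hd) ⟨p, q, hpq, hcon, rfl⟩

theorem exists_maximal_block (h : ¬ IsSimpleWord f n) :
    ∃ i j, IsBlock f 0 n i j ∧ i + 2 ≤ j ∧ j - i < n ∧
      ∀ p q, IsBlock f 0 n p q → p ≤ i → j ≤ q → j - i < q - p → p = 0 ∧ q = n := by
  classical
  have hex : ∃ d i j, IsBlock f 0 n i j ∧ i + 2 ≤ j ∧ j - i < n ∧ n - (j - i) = d := by
    simp only [IsSimpleWord, not_forall] at h
    obtain ⟨i, j, hb, hij, hne⟩ := h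
    have := hb.2.2.1
    exact ⟨_, i, j, hb, hij, by omega, rfl⟩
  obtain ⟨i, j, hb, hij, hlt, hd⟩ := Nat.find_spec hex
  refine ⟨i, j, hb, hij, hlt, fun p q hpq hp hq hlt' => ?_⟩
  have := hpq.2.2.1
  by_contra hcon
  exact Nat.find_min hex (m := n - (q - p)) (by omega) ⟨p, q, hpq, by omega, by omega, rfl⟩

/-- A word of length at least five that contains `2413` or `3142` shares its intervals with at
least three permutations. -/
theorem HasThird.of_not_avoidsOn (hn : 5 ≤ n) (hf : Set.InjOn f (Set.Ico 0 n))
    (h : ¬ AvoidsOn f 0 n) : HasThird f 0 n := by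
  obtain ⟨i, j, hb, hav, hmin⟩ := exists_minimal_not_avoidsOn (by omega) h
  have hjn := hb.2.2.1
  -- The parts of a split would be smaller blocks, which avoid both patterns by minimality, and then
  -- so would `[i, j)`.
  have hind : Indecomposable f i j := fun c h1 h2 hc => hav <| .of_splitAt hc
    (hmin i c (hb.trans (hc.isBlock_left h1 h2.le)) (by omega))
    (hmin c j (hb.trans (hc.isBlock_right h1.le h2)) (by omega))
  have hij : i + 2 ≤ j := by
    by_contra hlt
    exact hav fun p q r s _ _ _ _ _ => by omega
  by_cases hlt : j - i < n
  · exact .of_indecomposable_block hf hb hind hij hlt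
  obtain rfl : i = 0 := by omega
  obtain rfl : j = n := by omega
  by_cases hs : IsSimpleWord f j
  · exact .of_isSimpleWord hn hs
  obtain ⟨p, q, hpq, h2, hlt', hmax⟩ := exists_maximal_block hs
  exact .of_maximal_block hf hpq hind h2 hlt' hmax

/-! ### Permutations as words -/

/-- The word of a permutation, as a function on `[0, n)`. -/
def wordOf (σ : Equiv.Perm (Fin n)) (i : ℕ) : ℤ :=
  if h : i < n then ((σ ⟨i, h⟩ : ℕ) : ℤ) else 0

@[simp]
theorem wordOf_val (σ : Equiv.Perm (Fin n)) (i : Fin n) : wordOf σ i = ((σ i : ℕ) : ℤ) := by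
  simp [wordOf]

theorem wordOf_lt_wordOf (σ : Equiv.Perm (Fin n)) (i j : Fin n) :
    wordOf σ i < wordOf σ j ↔ σ i < σ j := by
  simp

theorem wordOf_injOn (σ : Equiv.Perm (Fin n)) : Set.InjOn (wordOf σ) (Set.Ico 0 n) := by
  intro x hx y hy h
  have h' : wordOf σ (⟨x, hx.2⟩ : Fin n) = wordOf σ (⟨y, hy.2⟩ : Fin n) := h
  rw [wordOf_val, wordOf_val, Int.natCast_inj, Fin.val_inj, σ.apply_eq_iff_eq] at h'
  exact congrArg Fin.val h'

theorem sameOrder_wordOf_iff {f : ℕ → ℤ} (τ : Equiv.Perm (Fin n)) :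
    SameOrder f (wordOf τ) 0 n ↔ ∀ i j : Fin n, f i < f j ↔ τ i < τ j := by
  constructor
  · intro h i j
    rw [← wordOf_lt_wordOf]
    exact h i j (Nat.zero_le _) i.2 (Nat.zero_le _) j.2
  · intro h x y _ hx _ hy
    exact (h ⟨x, hx⟩ ⟨y, hy⟩).trans (wordOf_lt_wordOf τ ⟨x, hx⟩ ⟨y, hy⟩).symm

/-- Standardisation: `Tuple.sort` lists positions by increasing letter, so its inverse gives each
position its rank. -/
theorem exists_perm_sameOrder (hg : Set.InjOn g (Set.Ico 0 n)) :
    ∃ τ : Equiv.Perm (Fin n), SameOrder g (wordOf τ) 0 n := by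
  refine ⟨(Tuple.sort fun i : Fin n => g i).symm, ?_⟩
  have hm : StrictMono ((fun i : Fin n => g i) ∘ Tuple.sort fun i : Fin n => g i) := by
    refine (Tuple.monotone_sort _).strictMono_of_injective
      (Function.Injective.comp ?_ (Equiv.injective _))
    intro x y h
    exact Fin.ext (hg ⟨Nat.zero_le _, x.2⟩ ⟨Nat.zero_le _, y.2⟩ h)
  rw [sameOrder_wordOf_iff]
  intro i j
  rw [← hm.lt_iff_lt]
  simp

theorem eq_of_strictMono {φ : Fin n → Fin n} (h : StrictMono φ) (i : Fin n) : φ i = i := by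
  have := Subsingleton.elim
    (h.orderIsoOfSurjective φ (Finite.surjective_of_injective h.injective)) (OrderIso.refl _)
  exact DFunLike.congr_fun this i

theorem eq_of_sameOrder {σ τ : Equiv.Perm (Fin n)} (h : SameOrder (wordOf σ) (wordOf τ) 0 n) :
    σ = τ := by
  rw [sameOrder_wordOf_iff] at h
  have hm : StrictMono (fun i => τ (σ.symm i)) := fun i j hij => by
    rw [← h, wordOf_lt_wordOf]
    simpa using hij
  ext i
  have := eq_of_strictMono hm (σ i)
  simp only [Equiv.symm_apply_apply] at this
  rw [this]

/-- The permutation with the order of its values reversed. -/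
def complementPerm (σ : Equiv.Perm (Fin n)) : Equiv.Perm (Fin n) := σ.trans Fin.revPerm

@[simp]
theorem complementPerm_apply (σ : Equiv.Perm (Fin n)) (i : Fin n) :
    complementPerm σ i = (σ i).rev := rfl

@[simp]
theorem complementPerm_complementPerm (σ : Equiv.Perm (Fin n)) :
    complementPerm (complementPerm σ) = σ := by
  ext; simp

theorem sameOrder_complementPerm (σ : Equiv.Perm (Fin n)) :
    SameOrder (-wordOf σ) (wordOf (complementPerm σ)) 0 n := by
  rw [sameOrder_wordOf_iff]
  simp

theorem complementPerm_ne (hn : 2 ≤ n) (σ : Equiv.Perm (Fin n)) : complementPerm σ ≠ σ := by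
  intro h
  have h0 : σ ⟨0, by omega⟩ < σ ⟨1, by omega⟩ ↔ σ ⟨1, by omega⟩ < σ ⟨0, by omega⟩ := by
    conv_lhs => rw [← h]
    simp
  have h1 : σ ⟨0, by omega⟩ ≠ σ ⟨1, by omega⟩ := by simp
  rcases h1.lt_or_gt with h2 | h2
  · exact lt_asymm h2 (h0.1 h2)
  · exact lt_asymm h2 (h0.2 h2)

theorem sameBlocks_complementPerm (σ : Equiv.Perm (Fin n)) :
    SameBlocks (wordOf (complementPerm σ)) (wordOf σ) 0 n :=
  sameBlocks_neg_right.1 (sameOrder_complementPerm σ).symm.sameBlocks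

theorem isSeparablePerm_iff (σ : Equiv.Perm (Fin n)) :
    IsSeparablePerm σ ↔ AvoidsOn (wordOf σ) 0 n := by
  constructor
  · rintro ⟨h1, h2⟩ p q r s - hpq hqr hrs hs
    have hm : StrictMono (![⟨p, by omega⟩, ⟨q, by omega⟩, ⟨r, by omega⟩, ⟨s, hs⟩] :
        Fin 4 → Fin n) := by
      rw [Fin.strictMono_iff_lt_succ]
      intro i
      fin_cases i <;> simpa
    have hw := fun i : Fin n => wordOf_val σ i
    have wp := hw ⟨p, by omega⟩
    have wq := hw ⟨q, by omega⟩
    have wr := hw ⟨r, by omega⟩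
    have ws := hw ⟨s, hs⟩
    simp only at wp wq wr ws
    rw [wp, wq, wr, ws]
    constructor
    · rintro ⟨k1, k2, k3⟩
      refine h1 ⟨_, hm, fun a b => ?_⟩
      fin_cases a <;> fin_cases b <;> simp [perm2413, Fin.lt_def, -Fin.val_fin_lt] <;> omega
    · rintro ⟨k1, k2, k3⟩
      refine h2 ⟨_, hm, fun a b => ?_⟩
      fin_cases a <;> fin_cases b <;> simp [perm3142, Fin.lt_def, -Fin.val_fin_lt] <;> omega
  · intro h
    constructor
    · rintro ⟨f, hf, hab⟩
      refine (h (f 0) (f 1) (f 2) (f 3) (Nat.zero_le _) (hf (by decide)) (hf (by decide))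
        (hf (by decide)) (f 3).2).1 ?_
      simp only [wordOf_lt_wordOf, hab]
      decide
    · rintro ⟨f, hf, hab⟩
      refine (h (f 0) (f 1) (f 2) (f 3) (Nat.zero_le _) (hf (by decide)) (hf (by decide))
        (hf (by decide)) (f 3).2).2 ?_
      simp only [wordOf_lt_wordOf, hab]
      decide

/-! ### Interval posets and blocks -/

/-- The block condition says that no value between the extreme values of the range is taken
elsewhere. The closed range `[i, j]` becomes the half-open `[i, j + 1)`. -/
theorem isPermInterval_iff (σ : Equiv.Perm (Fin n)) (i j : Fin n) :
    IsPermInterval σ (σ '' Set.Icc i j) ↔ IsBlock (wordOf σ) 0 n i (j + 1) := by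
  constructor
  · rintro ⟨h1, ⟨a, b, hab⟩, -⟩
    have hij : i ≤ j := Set.nonempty_Icc.1 (Set.image_nonempty.1 h1)
    refine ⟨Nat.zero_le _, by have := Fin.le_def.1 hij; omega, j.2, ?_⟩
    intro k x y _ hk hk' hx hx' hy hy' k1 k2
    have mem : ∀ x (hx : (i : ℕ) ≤ x) (hx' : x < j + 1), σ ⟨x, by omega⟩ ∈ Set.Icc a b := by
      intro x hx hx'
      rw [← hab]
      exact ⟨_, ⟨Fin.le_def.2 hx, Fin.le_def.2 (by simp; omega)⟩, rfl⟩
    have hmx := mem x hx hx'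
    have hmy := mem y hy hy'
    have e1 := (wordOf_lt_wordOf σ ⟨x, by omega⟩ ⟨k, hk⟩).1 k1
    have e2 := (wordOf_lt_wordOf σ ⟨k, hk⟩ ⟨y, by omega⟩).1 k2
    have : σ ⟨k, hk⟩ ∈ σ '' Set.Icc i j := by
      rw [hab]
      exact ⟨hmx.1.trans e1.le, e2.le.trans hmy.2⟩
    obtain ⟨l, hl, hl'⟩ := this
    rw [σ.apply_eq_iff_eq] at hl'
    subst hl'
    simp only [Set.mem_Icc, Fin.le_def] at hl
    omega
  · rintro ⟨-, h1, h2, h3⟩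
    have hij : i ≤ j := Fin.le_def.2 (by omega)
    have hne : (σ '' Set.Icc i j).Nonempty := (Set.nonempty_Icc.2 hij).image _
    refine ⟨hne, ?_, i, j, rfl⟩
    obtain ⟨u, hu, hu'⟩ := Set.exists_min_image (Set.Icc i j) σ (Set.toFinite _)
      (Set.nonempty_Icc.2 hij)
    obtain ⟨v, hv, hv'⟩ := Set.exists_max_image (Set.Icc i j) σ (Set.toFinite _)
      (Set.nonempty_Icc.2 hij)
    refine ⟨σ u, σ v, Set.Subset.antisymm ?_ ?_⟩
    · rintro _ ⟨x, hx, rfl⟩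
      exact ⟨hu' x hx, hv' x hx⟩
    · rintro z ⟨hz, hz'⟩
      refine ⟨σ.symm z, ?_, by simp⟩
      by_contra hout
      simp only [Set.mem_Icc, Fin.le_def] at hout hu hv
      have n1 : u ≠ σ.symm z := by rintro rfl; exact hout hu
      have n2 : v ≠ σ.symm z := by rintro rfl; exact hout hv
      refine h3 (σ.symm z) u v (Nat.zero_le _) (Fin.is_lt _) (by omega) hu.1 (by omega) hv.1
        (by omega) ?_ ?_
      · rw [wordOf_lt_wordOf, σ.apply_symm_apply]
        exact lt_of_le_of_ne hz fun h => n1 (by simp [← h])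
      · rw [wordOf_lt_wordOf, σ.apply_symm_apply]
        exact lt_of_le_of_ne hz' fun h => n2 (by simp [h])

theorem sameBlocks_iff (σ τ : Equiv.Perm (Fin n)) :
    SameBlocks (wordOf τ) (wordOf σ) 0 n ↔
      ∀ i j : Fin n, IsPermInterval τ (τ '' Set.Icc i j) ↔ IsPermInterval σ (σ '' Set.Icc i j) := by
  simp only [isPermInterval_iff]
  constructor
  · exact fun h i j => h i (j + 1)
  · intro h i j
    by_cases hij : i < j ∧ j ≤ n
    · have := h ⟨i, by omega⟩ ⟨j - 1, by omega⟩
      simp only at this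
      rwa [Nat.sub_add_cancel (by omega)] at this
    · exact iff_of_false (fun h' => hij ⟨h'.2.1, h'.2.2.1⟩) fun h' => hij ⟨h'.2.1, h'.2.2.1⟩

/-- The minimal element `{σ i}` of the interval poset. -/
def permAtom (σ : Equiv.Perm (Fin n)) (i : Fin n) :
    {x : (intervalPlanePoset σ).carrier // IsMin x} :=
  ⟨⟨{σ i}, isPermInterval_singleton σ i⟩, fun J hJ => by
    obtain ⟨v, hv⟩ := J.2.1
    have hv' : v = σ i := hJ hv
    subst hv'
    exact Set.singleton_subset_iff.2 hv⟩

theorem leftOf_permAtom (σ : Equiv.Perm (Fin n)) (i j : Fin n) :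
    (intervalPlanePoset σ).leftOf (permAtom σ i) (permAtom σ j) ↔ i < j := by
  constructor
  · rintro ⟨k, l, hkl, h1, h2⟩
    have h1' : i = k := by simpa [permAtom] using h1
    have h2' : j = l := by simpa [permAtom] using h2
    rwa [h1', h2']
  · exact fun h => ⟨i, j, h, rfl, rfl⟩

theorem exists_permAtom_eq (σ : Equiv.Perm (Fin n))
    (x : {x : (intervalPlanePoset σ).carrier // IsMin x}) : ∃ i, permAtom σ i = x := by
  obtain ⟨i, hi⟩ := PermInterval.exists_eq_of_isMin σ x.1 x.2
  exact ⟨i, Subtype.ext (Subtype.ext hi.symm)⟩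

theorem PlanePoset.Iso.exists_strictMono {m : ℕ} {τ : Equiv.Perm (Fin m)} {σ : Equiv.Perm (Fin n)}
    (e : (intervalPlanePoset τ).carrier ≃o (intervalPlanePoset σ).carrier)
    (he : ∀ x y, (intervalPlanePoset τ).leftOf x y ↔ (intervalPlanePoset σ).leftOf
      ⟨e x.1, e.isMin_apply.2 x.2⟩ ⟨e y.1, e.isMin_apply.2 y.2⟩) :
    ∃ φ : Fin m → Fin n, StrictMono φ ∧ ∀ i, e (permAtom τ i).1 = (permAtom σ (φ i)).1 := by
  have h : ∀ i, ∃ k, permAtom σ k = ⟨e (permAtom τ i).1, e.isMin_apply.2 (permAtom τ i).2⟩ :=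
    fun i => exists_permAtom_eq σ _
  choose φ hφ using h
  refine ⟨φ, fun i j hij => ?_, fun i => by rw [hφ]⟩
  rw [← leftOf_permAtom τ, he, ← hφ, ← hφ, leftOf_permAtom] at hij
  exact hij

theorem size_eq_of_iso {m : ℕ} {τ : Equiv.Perm (Fin m)} {σ : Equiv.Perm (Fin n)}
    (h : (intervalPlanePoset τ).Iso (intervalPlanePoset σ)) : m = n := by
  have key : ∀ {m n : ℕ} {τ : Equiv.Perm (Fin m)} {σ : Equiv.Perm (Fin n)},
      (intervalPlanePoset τ).Iso (intervalPlanePoset σ) → m ≤ n := by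
    rintro m n τ σ ⟨e, he⟩
    obtain ⟨φ, hφ, -⟩ := PlanePoset.Iso.exists_strictMono e he
    simpa using Fintype.card_le_of_injective φ hφ.injective
  exact le_antisymm (key h) (key (PlanePoset.iso_equivalence.symm h))

theorem permAtom_le_iff (σ : Equiv.Perm (Fin n)) (i : Fin n) (I : (intervalPlanePoset σ).carrier) :
    (permAtom σ i).1 ≤ I ↔ σ i ∈ I.1 :=
  Set.singleton_subset_iff

/-- The map induced on positions is strictly monotone on `Fin n`, hence the identity. An interval is
determined by the atoms below it, so it keeps its positions. -/
theorem sameBlocks_of_iso {σ τ : Equiv.Perm (Fin n)}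
    (h : (intervalPlanePoset τ).Iso (intervalPlanePoset σ)) :
    SameBlocks (wordOf τ) (wordOf σ) 0 n := by
  have key : ∀ {σ τ : Equiv.Perm (Fin n)}, (intervalPlanePoset τ).Iso (intervalPlanePoset σ) →
      ∀ i j : Fin n, IsPermInterval τ (τ '' Set.Icc i j) → IsPermInterval σ (σ '' Set.Icc i j) := by
    rintro σ τ ⟨e, he⟩ i j hI
    obtain ⟨φ, hφ, hφ'⟩ := PlanePoset.Iso.exists_strictMono e he
    let I : (intervalPlanePoset τ).carrier := ⟨_, hI⟩
    have hJ : (e I).1 = σ '' Set.Icc i j := by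
      ext v
      obtain ⟨k, rfl⟩ := σ.surjective v
      rw [← permAtom_le_iff]
      conv_lhs => rw [← eq_of_strictMono hφ k]
      rw [← hφ', e.le_iff_le, permAtom_le_iff]
      simp [I]
    rw [← hJ]
    exact (e I).2
  rw [sameBlocks_iff]
  exact fun i j => ⟨key h i j, key (PlanePoset.iso_equivalence.symm h) i j⟩

/-- Relabelling values by `σ ∘ τ⁻¹` keeps positions, so it carries intervals to intervals and atoms
to atoms in order. -/
theorem iso_of_sameBlocks {σ τ : Equiv.Perm (Fin n)}
    (h : SameBlocks (wordOf τ) (wordOf σ) 0 n) :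
    (intervalPlanePoset τ).Iso (intervalPlanePoset σ) := by
  have key : ∀ {σ τ : Equiv.Perm (Fin n)}, SameBlocks (wordOf τ) (wordOf σ) 0 n →
      ∀ I, IsPermInterval τ I → IsPermInterval σ ((τ.symm.trans σ) '' I) := by
    rintro σ τ h I hI
    rw [sameBlocks_iff] at h
    have hI' := hI
    obtain ⟨-, -, i, j, rfl⟩ := hI'
    convert (h i j).1 hI using 1
    rw [← Set.image_comp]
    congr 1
    ext x
    simp
  let e : PermInterval τ ≃o PermInterval σ :=
    { toFun := fun I => ⟨_, key h I.1 I.2⟩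
      invFun := fun I => ⟨_, key h.symm I.1 I.2⟩
      left_inv := fun I => Subtype.ext (by simp [← Set.image_comp, Function.comp_def])
      right_inv := fun I => Subtype.ext (by simp [← Set.image_comp, Function.comp_def])
      map_rel_iff' := by
        intro I J
        exact Set.image_subset_image_iff (τ.symm.trans σ).injective }
  refine ⟨e, fun x y => ?_⟩
  obtain ⟨i, rfl⟩ := exists_permAtom_eq τ x
  obtain ⟨j, rfl⟩ := exists_permAtom_eq τ y
  have he : ∀ i, e (permAtom τ i).1 = (permAtom σ i).1 := fun i => Subtype.ext (by
    change (τ.symm.trans σ) '' {τ i} = {σ i}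
    simp)
  rw [leftOf_permAtom, ← leftOf_permAtom σ]
  exact iff_of_eq (congrArg₂ (intervalPlanePoset σ).leftOf (Subtype.ext (he i).symm)
    (Subtype.ext (he j).symm))

theorem intervalPoset_eq_iff (σ τ : Equiv.Perm (Fin n)) :
    intervalPoset ⟨n, τ⟩ = intervalPoset ⟨n, σ⟩ ↔ SameBlocks (wordOf τ) (wordOf σ) 0 n :=
  Quotient.eq.trans ⟨sameBlocks_of_iso, iso_of_sameBlocks⟩

/-! ### Counting realizers -/

theorem realizers_intervalPoset (σ : Equiv.Perm (Fin n)) :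
    realizers (intervalPoset ⟨n, σ⟩) =
      Sigma.mk n '' {τ | SameBlocks (wordOf τ) (wordOf σ) 0 n} := by
  ext ⟨m, τ⟩
  constructor
  · intro h
    obtain rfl : m = n := size_eq_of_iso (Quotient.exact h)
    exact ⟨τ, (intervalPoset_eq_iff σ τ).1 h, rfl⟩
  · rintro ⟨τ', h, h'⟩
    rw [← h']
    exact (intervalPoset_eq_iff σ τ').2 h

theorem encard_realizers (σ : Equiv.Perm (Fin n)) :
    (realizers (intervalPoset ⟨n, σ⟩)).encard =
      {τ : Equiv.Perm (Fin n) | SameBlocks (wordOf τ) (wordOf σ) 0 n}.encard := by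
  rw [realizers_intervalPoset]
  exact Function.Injective.encard_image sigma_mk_injective _

theorem encard_realizers_eq_two_iff (hn : 2 ≤ n) (σ : Equiv.Perm (Fin n)) :
    (realizers (intervalPoset ⟨n, σ⟩)).encard = 2 ↔
      ∀ τ : Equiv.Perm (Fin n), SameBlocks (wordOf τ) (wordOf σ) 0 n → τ = σ ∨ τ = complementPerm σ := by
  rw [encard_realizers]
  have hne := (complementPerm_ne hn σ).symm
  have hsub : {σ, complementPerm σ} ⊆
      {τ : Equiv.Perm (Fin n) | SameBlocks (wordOf τ) (wordOf σ) 0 n} := by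
    rintro τ (rfl | rfl)
    · exact fun i j => Iff.rfl
    · exact sameBlocks_complementPerm σ
  constructor
  · intro h τ hτ
    have := (Set.toFinite _).eq_of_subset_of_encard_le hsub (by rw [h, Set.encard_pair hne])
    have hτ' : τ ∈ ({σ, complementPerm σ} : Set _) := by rw [this]; exact hτ
    exact hτ'
  · intro h
    rw [← Set.encard_pair hne]
    exact congrArg _ (Set.Subset.antisymm (fun τ hτ => h τ hτ) hsub)

theorem HasThird.encard_realizers_ne_two (hn : 2 ≤ n) (σ : Equiv.Perm (Fin n))
    (h : HasThird (wordOf σ) 0 n) : (realizers (intervalPoset ⟨n, σ⟩)).encard ≠ 2 := by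
  rw [Ne, encard_realizers_eq_two_iff hn]
  obtain ⟨g, hg, hb, h1, h2⟩ := h
  obtain ⟨τ, hτ⟩ := exists_perm_sameOrder hg
  intro hall
  rcases hall τ (hτ.symm.sameBlocks.trans hb.symm) with rfl | rfl
  · exact h1 hτ.symm
  · exact h2 (by simpa using ((hτ.trans (sameOrder_complementPerm σ).symm).symm).neg)

theorem IsSeparablePerm.encard_realizers (hn : 2 ≤ n) {σ : Equiv.Perm (Fin n)}
    (h : IsSeparablePerm σ) : (realizers (intervalPoset ⟨n, σ⟩)).encard = 2 := by
  rw [encard_realizers_eq_two_iff hn]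
  intro τ hτ
  rw [isSeparablePerm_iff] at h
  rcases h.rigid (wordOf_injOn σ) (wordOf_injOn τ) hτ.symm with h1 | h1
  · exact Or.inl (eq_of_sameOrder h1).symm
  · refine Or.inr (eq_of_sameOrder ?_)
    have := h1.neg
    rw [neg_neg] at this
    exact this.symm.trans (sameOrder_complementPerm σ)

/-- By rigidity `τ` is `σ` or its complement, and complementation exchanges the two forbidden
patterns. -/
theorem isSeparablePerm_congr {σ τ : Equiv.Perm (Fin n)}
    (h : SameBlocks (wordOf τ) (wordOf σ) 0 n) (hσ : IsSeparablePerm σ) : IsSeparablePerm τ := by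
  rw [isSeparablePerm_iff] at *
  rcases hσ.rigid (wordOf_injOn σ) (wordOf_injOn τ) h.symm with h1 | h1
  · exact hσ.congr h1
  · simpa using (hσ.congr h1).neg

theorem ContainsPattern.le_size {k : ℕ} {σ : Equiv.Perm (Fin n)} {π : Equiv.Perm (Fin k)}
    (h : ContainsPattern σ π) : k ≤ n := by
  obtain ⟨f, hf, -⟩ := h
  simpa using Fintype.card_le_of_injective f hf.injective

theorem ContainsPattern.eq {σ π : Equiv.Perm (Fin n)} (h : ContainsPattern σ π) : σ = π := by
  obtain ⟨f, hf, hab⟩ := h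
  refine eq_of_sameOrder ((sameOrder_wordOf_iff π).2 fun i j => ?_)
  rw [wordOf_lt_wordOf, ← hab, eq_of_strictMono hf, eq_of_strictMono hf]

theorem containsPattern_self (σ : Equiv.Perm (Fin n)) : ContainsPattern σ σ :=
  ⟨id, strictMono_id, fun _ _ => Iff.rfl⟩

theorem not_isSeparablePerm_iff_of_four (σ : Equiv.Perm (Fin 4)) :
    ¬ IsSeparablePerm σ ↔ σ = perm2413 ∨ σ = perm3142 := by
  constructor
  · intro h
    rw [IsSeparablePerm, not_and_or, not_not, not_not] at h
    exact h.imp (fun h => h.eq) fun h => h.eq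
  · rintro (rfl | rfl) h
    · exact h.1 (containsPattern_self _)
    · exact h.2 (containsPattern_self _)

theorem complementPerm_perm2413 : complementPerm perm2413 = perm3142 := by
  ext i
  fin_cases i <;> rfl

theorem complementPerm_perm3142 : complementPerm perm3142 = perm2413 := by
  rw [← complementPerm_perm2413, complementPerm_complementPerm]

/-- Separability depends only on the blocks, so every realizer is 2413 or 3142. -/
theorem encard_realizers_of_not_isSeparablePerm_of_four {σ : Equiv.Perm (Fin 4)}
    (h : ¬ IsSeparablePerm σ) : (realizers (intervalPoset ⟨4, σ⟩)).encard = 2 := by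
  rw [encard_realizers_eq_two_iff (by norm_num)]
  intro τ hτ
  have h' : ¬ IsSeparablePerm τ := fun h' => h (isSeparablePerm_congr hτ.symm h')
  rw [not_isSeparablePerm_iff_of_four] at h h'
  rcases h with rfl | rfl <;> rcases h' with rfl | rfl <;>
    simp [complementPerm_perm2413, complementPerm_perm3142]

theorem encard_realizers_ne_two_of_size_le_one (hn : n ≤ 1) (σ : Equiv.Perm (Fin n)) :
    (realizers (intervalPoset ⟨n, σ⟩)).encard ≠ 2 := by
  intro h
  have hs : Subsingleton (Fin n) := Fin.subsingleton_iff_le_one.2 hn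
  rw [encard_realizers] at h
  have := Set.encard_le_one_iff_subsingleton.2
    (Set.subsingleton_of_subsingleton (s := {τ : Equiv.Perm (Fin n) | SameBlocks (wordOf τ) (wordOf σ) 0 n}))
  rw [h] at this
  exact absurd this (by norm_num)

/-- The interval poset of `σ` has exactly two realizers iff `σ` is separable of size at least two,
or non-separable of size four. -/
theorem encard_realizers_eq_two_iff_isSeparablePerm (σ : Equiv.Perm (Fin n)) :
    (realizers (intervalPoset ⟨n, σ⟩)).encard = 2 ↔
      2 ≤ n ∧ (IsSeparablePerm σ ∨ n = 4) := by
  constructor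
  · intro h
    have hn : 2 ≤ n := by
      by_contra hlt
      exact encard_realizers_ne_two_of_size_le_one (by omega) σ h
    refine ⟨hn, ?_⟩
    by_contra hcon
    rw [not_or] at hcon
    -- Containing a pattern of size four forces `4 ≤ n`; with `n ≠ 4` this gives the bound five
    -- needed for a third word.
    have h4 : 4 ≤ n := by
      have h' := hcon.1
      rw [IsSeparablePerm, not_and_or, not_not, not_not] at h'
      exact h'.elim (fun h => h.le_size) fun h => h.le_size
    rw [isSeparablePerm_iff] at hcon
    exact (HasThird.of_not_avoidsOn (by omega) (wordOf_injOn σ) hcon.1).encard_realizers_ne_two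
      hn σ h
  · rintro ⟨hn, h⟩
    by_cases hs : IsSeparablePerm σ
    · exact hs.encard_realizers hn
    · obtain rfl := h.resolve_left hs
      exact encard_realizers_of_not_isSeparablePerm_of_four hs

theorem encard_realizers_eq_two_iff_pattern (σ : Permutation) :
    (realizers (intervalPoset σ)).encard = 2 ↔
      (2 ≤ σ.1 ∧ IsSeparablePerm σ.2) ∨
        σ = (⟨4, perm2413⟩ : Permutation) ∨ σ = (⟨4, perm3142⟩ : Permutation) := by
  obtain ⟨n, σ⟩ := σ
  rw [encard_realizers_eq_two_iff_isSeparablePerm]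
  constructor
  · rintro ⟨hn, h⟩
    by_cases hs : IsSeparablePerm σ
    · exact Or.inl ⟨hn, hs⟩
    · obtain rfl := h.resolve_left hs
      exact Or.inr (((not_isSeparablePerm_iff_of_four σ).1 hs).imp (by rintro rfl; rfl)
        (by rintro rfl; rfl))
  · rintro (⟨hn, h⟩ | h | h)
    · exact ⟨hn, Or.inl h⟩
    · obtain rfl : n = 4 := congrArg Sigma.fst h
      exact ⟨by norm_num, Or.inr rfl⟩
    · obtain rfl : n = 4 := congrArg Sigma.fst h
      exact ⟨by norm_num, Or.inr rfl⟩

/-! ### Counting separable permutations -/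

/-- The direct sum of two permutations. -/
def directSumPerm {k l : ℕ} (α : Equiv.Perm (Fin k)) (β : Equiv.Perm (Fin l)) :
    Equiv.Perm (Fin (k + l)) :=
  finSumFinEquiv.permCongr (Equiv.Perm.sumCongr α β)

theorem directSumPerm_injective {k l : ℕ} : Function.Injective
    fun x : Equiv.Perm (Fin k) × Equiv.Perm (Fin l) => directSumPerm x.1 x.2 :=
  finSumFinEquiv.permCongr.injective.comp Equiv.Perm.sumCongrHom_injective

theorem wordOf_directSumPerm_left {k l : ℕ} (α : Equiv.Perm (Fin k)) (β : Equiv.Perm (Fin l))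
    {x : ℕ} (hx : x < k) : wordOf (directSumPerm α β) x = wordOf α x := by
  have h1 : directSumPerm α β (Fin.castAdd l ⟨x, hx⟩) = Fin.castAdd l (α ⟨x, hx⟩) := by
    simp [directSumPerm, Equiv.permCongr_apply, -Fin.castAdd_mk]
  have h2 := wordOf_val (directSumPerm α β) (Fin.castAdd l ⟨x, hx⟩)
  rw [h1] at h2
  have h3 := wordOf_val α ⟨x, hx⟩
  simp only [Fin.val_castAdd] at h2 h3
  rw [h2, h3]

theorem wordOf_directSumPerm_right {k l : ℕ} (α : Equiv.Perm (Fin k)) (β : Equiv.Perm (Fin l))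
    {x : ℕ} (hx : x < l) : wordOf (directSumPerm α β) (x + k) = wordOf β x + k := by
  have h1 : directSumPerm α β (Fin.natAdd k ⟨x, hx⟩) = Fin.natAdd k (β ⟨x, hx⟩) := by
    simp [directSumPerm, Equiv.permCongr_apply, -Fin.natAdd_mk]
  have h2 := wordOf_val (directSumPerm α β) (Fin.natAdd k ⟨x, hx⟩)
  rw [h1] at h2
  have h3 := wordOf_val β ⟨x, hx⟩
  simp only [Fin.val_natAdd] at h2 h3
  rw [h3, ← Nat.cast_add, add_comm (β ⟨x, hx⟩ : ℕ) k, ← h2]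
  exact congrArg _ (add_comm x k)

theorem wordOf_nonneg (σ : Equiv.Perm (Fin n)) (x : ℕ) : 0 ≤ wordOf σ x := by
  unfold wordOf
  split_ifs <;> positivity

theorem wordOf_lt (σ : Equiv.Perm (Fin n)) {x : ℕ} (hx : x < n) : wordOf σ x < n := by
  simp [wordOf, hx]

theorem sumAt_directSumPerm {k l : ℕ} (α : Equiv.Perm (Fin k)) (β : Equiv.Perm (Fin l)) :
    SumAt (wordOf (directSumPerm α β)) 0 (k + l) k := by
  intro x y _ hx hy hy'
  obtain ⟨y, rfl⟩ := Nat.exists_eq_add_of_le' hy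
  rw [wordOf_directSumPerm_left α β hx, wordOf_directSumPerm_right α β (by omega)]
  have := wordOf_lt α hx
  have := wordOf_nonneg β y
  omega

theorem sameOrder_directSumPerm_left {k l : ℕ} (α : Equiv.Perm (Fin k)) (β : Equiv.Perm (Fin l)) :
    SameOrder (wordOf (directSumPerm α β)) (wordOf α) 0 k := by
  intro x y _ hx _ hy
  rw [wordOf_directSumPerm_left α β hx, wordOf_directSumPerm_left α β hy]

theorem sameOrder_directSumPerm_right {k l : ℕ} (α : Equiv.Perm (Fin k)) (β : Equiv.Perm (Fin l)) :
    SameOrder (fun i => wordOf (directSumPerm α β) (i + k)) (wordOf β) 0 l := by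
  intro x y _ hx _ hy
  simp only [wordOf_directSumPerm_right α β hx, wordOf_directSumPerm_right α β hy]
  omega

theorem sameOrder_shift {k l : ℕ} :
    SameOrder (fun i => f (i + k)) (fun i => g (i + k)) 0 l ↔ SameOrder f g k (k + l) := by
  constructor
  · intro h x y h1 h2 h3 h4
    obtain ⟨x, rfl⟩ := Nat.exists_eq_add_of_le' h1
    obtain ⟨y, rfl⟩ := Nat.exists_eq_add_of_le' h3
    exact h x y (by omega) (by omega) (by omega) (by omega)
  · intro h x y h1 h2 h3 h4
    exact h (x + k) (y + k) (by omega) (by omega) (by omega) (by omega)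

theorem avoidsOn_shift {k l : ℕ} :
    AvoidsOn (fun i => f (i + k)) 0 l ↔ AvoidsOn f k (k + l) := by
  constructor
  · intro h p q r s h1 h2 h3 h4 h5
    obtain ⟨p, rfl⟩ := Nat.exists_eq_add_of_le' h1
    obtain ⟨q, rfl⟩ := Nat.exists_eq_add_of_le' (show k ≤ q by omega)
    obtain ⟨r, rfl⟩ := Nat.exists_eq_add_of_le' (show k ≤ r by omega)
    obtain ⟨s, rfl⟩ := Nat.exists_eq_add_of_le' (show k ≤ s by omega)
    exact h p q r s (by omega) (by omega) (by omega) (by omega) (by omega)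
  · intro h p q r s h1 h2 h3 h4 h5
    exact h (p + k) (q + k) (r + k) (s + k) (by omega) (by omega) (by omega) (by omega) (by omega)

theorem exists_eq_directSumPerm {k l : ℕ} (σ : Equiv.Perm (Fin (k + l)))
    (h : SumAt (wordOf σ) 0 (k + l) k) : ∃ α β, directSumPerm α β = σ := by
  obtain ⟨α, hα⟩ := exists_perm_sameOrder (n := k)
    ((wordOf_injOn σ).mono (Set.Ico_subset_Ico le_rfl (by omega)))
  obtain ⟨β, hβ⟩ := exists_perm_sameOrder (g := fun i => wordOf σ (i + k)) (n := l) (by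
    intro x hx y hy hxy
    have := wordOf_injOn σ ⟨Nat.zero_le (x + k), by have := hx.2; omega⟩
      ⟨Nat.zero_le (y + k), by have := hy.2; omega⟩ hxy
    omega)
  refine ⟨α, β, eq_of_sameOrder ((sumAt_directSumPerm α β).sameOrder h
    ((sameOrder_directSumPerm_left α β).trans hα.symm) ?_)⟩
  exact sameOrder_shift.1 ((sameOrder_directSumPerm_right α β).trans hβ.symm)

theorem isSeparablePerm_directSumPerm {k l : ℕ} (α : Equiv.Perm (Fin k)) (β : Equiv.Perm (Fin l)) :
    IsSeparablePerm (directSumPerm α β) ↔ IsSeparablePerm α ∧ IsSeparablePerm β := by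
  simp only [isSeparablePerm_iff]
  constructor
  · exact fun h => ⟨(h.mono le_rfl (by omega)).congr (sameOrder_directSumPerm_left α β),
      (avoidsOn_shift.2 (h.mono (by omega) le_rfl)).congr (sameOrder_directSumPerm_right α β)⟩
  · exact fun h => .of_sumAt (sumAt_directSumPerm α β)
      (h.1.congr (sameOrder_directSumPerm_left α β).symm)
      (avoidsOn_shift.1 (h.2.congr (sameOrder_directSumPerm_right α β).symm))

/-- The separable permutations of size `n`. -/
def separablePerms (n : ℕ) : Set (Equiv.Perm (Fin n)) := {σ | IsSeparablePerm σ}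

/-- The separable permutations of size `n` that are not direct sums with a first part of size less
than `k`. -/
def sumIndecomposables (n k : ℕ) : Set (Equiv.Perm (Fin n)) :=
  {σ | IsSeparablePerm σ ∧ ∀ c, 0 < c → c < k → ¬ SumAt (wordOf σ) 0 n c}

/-- The separable permutations of size `n` whose first sum-indecomposable part has size `k`. -/
def firstSplits (n k : ℕ) : Set (Equiv.Perm (Fin n)) :=
  {σ | σ ∈ sumIndecomposables n k ∧ SumAt (wordOf σ) 0 n k}

/-- Cut after the first sum component. A sum split of that component at `c` would be one of the
whole permutation, so the component is sum-indecomposable; the rest is an arbitrary separable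
permutation. -/
theorem firstSplits_eq_image (k l : ℕ) : firstSplits (k + l) k =
    (fun x : Equiv.Perm (Fin k) × Equiv.Perm (Fin l) => directSumPerm x.1 x.2) ''
      (sumIndecomposables k k ×ˢ separablePerms l) := by
  ext σ
  constructor
  · rintro ⟨⟨h1, h2⟩, h3⟩
    obtain ⟨α, β, rfl⟩ := exists_eq_directSumPerm σ h3
    obtain ⟨hα, hβ⟩ := (isSeparablePerm_directSumPerm α β).1 h1
    refine ⟨(α, β), ⟨⟨hα, fun c hc hck hs => h2 c hc hck ?_⟩, hβ⟩, rfl⟩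
    intro x y hx hxc hcy hy
    rcases lt_or_ge y k with hyk | hyk
    · exact (sameOrder_directSumPerm_left α β x y hx (by omega) (by omega) hyk).2
        (hs x y hx hxc hcy hyk)
    · exact h3 x y hx (by omega) hyk hy
  · rintro ⟨⟨α, β⟩, ⟨⟨hα, hi⟩, hβ⟩, rfl⟩
    refine ⟨⟨(isSeparablePerm_directSumPerm α β).2 ⟨hα, hβ⟩, fun c hc hck hs => hi c hc hck ?_⟩,
      sumAt_directSumPerm α β⟩
    exact (hs.mono le_rfl (by omega)).congr (sameOrder_directSumPerm_left α β) (by omega) hck.le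

theorem ncard_firstSplits (k l : ℕ) : (firstSplits (k + l) k).ncard =
    (sumIndecomposables k k).ncard * (separablePerms l).ncard := by
  rw [firstSplits_eq_image, Set.ncard_image_of_injective _ directSumPerm_injective, Set.ncard_prod]

theorem ncard_sumIndecomposables_succ {k : ℕ} (hk : 0 < k) :
    (sumIndecomposables n k).ncard =
      (sumIndecomposables n (k + 1)).ncard + (firstSplits n k).ncard := by
  rw [← Set.ncard_union_eq]
  · congr 1
    ext σ
    constructor
    · intro h
      by_cases hs : SumAt (wordOf σ) 0 n k
      · exact Or.inr ⟨h, hs⟩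
      · refine Or.inl ⟨h.1, fun c hc hck => ?_⟩
        rcases Nat.lt_succ_iff_lt_or_eq.1 hck with h' | rfl
        · exact h.2 c hc h'
        · exact hs
    · rintro (h | h)
      · exact ⟨h.1, fun c hc hck => h.2 c hc (by omega)⟩
      · exact h.1
  · rw [Set.disjoint_left]
    exact fun σ h h' => h.2 k hk (Nat.lt_succ_self k) h'.2

theorem sumIndecomposables_one : sumIndecomposables n 1 = separablePerms n := by
  ext σ
  exact ⟨fun h => h.1, fun h => ⟨h, fun c hc hc' => by omega⟩⟩

theorem ncard_separablePerms (k : ℕ) : (separablePerms n).ncard =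
    (sumIndecomposables n (k + 1)).ncard +
      ∑ i ∈ Finset.range k, (firstSplits n (i + 1)).ncard := by
  induction k with
  | zero => simp [sumIndecomposables_one]
  | succ k ih =>
    rw [ih, Finset.sum_range_succ, ncard_sumIndecomposables_succ (Nat.succ_pos k)]
    ring

theorem isSeparablePerm_complementPerm (σ : Equiv.Perm (Fin n)) :
    IsSeparablePerm (complementPerm σ) ↔ IsSeparablePerm σ :=
  ⟨isSeparablePerm_congr (sameBlocks_complementPerm σ).symm,
    isSeparablePerm_congr (sameBlocks_complementPerm σ)⟩

/-- Half of the separable permutations of size at least two are sum-indecomposable. -/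
theorem two_mul_ncard_sumIndecomposables (hn : 2 ≤ n) :
    2 * (sumIndecomposables n n).ncard = (separablePerms n).ncard := by
  have hinj : Function.Injective (complementPerm (n := n)) :=
    Function.LeftInverse.injective complementPerm_complementPerm
  rw [two_mul]
  nth_rewrite 2 [← Set.ncard_image_of_injective _ hinj]
  rw [← Set.ncard_union_eq]
  · congr 1
    ext σ
    constructor
    · rintro (h | ⟨τ, h, rfl⟩)
      · exact h.1
      · exact (isSeparablePerm_complementPerm τ).2 h.1
    · intro h
      by_cases hs : σ ∈ sumIndecomposables n n
      · exact Or.inl hs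
      have : ∃ c, 0 < c ∧ c < n ∧ SumAt (wordOf σ) 0 n c := by
        by_contra hcon
        exact hs ⟨h, fun c hc hcn hsum => hcon ⟨c, hc, hcn, hsum⟩⟩
      obtain ⟨c, hc, hcn, hsum⟩ := this
      refine Or.inr ⟨complementPerm σ, ⟨(isSeparablePerm_complementPerm σ).2 h,
        fun d hd hdn hsum' => ?_⟩, complementPerm_complementPerm σ⟩
      -- A direct sum and a skew sum order the first and last letters oppositely, so no word is
      -- both.
      have h1 := hsum 0 (n - 1) le_rfl hc (by omega) (by omega)
      have h2 := hsum'.congr (sameOrder_complementPerm σ).symm hd.le hdn.le 0 (n - 1) le_rfl hd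
        (by omega) (by omega)
      simp only [Pi.neg_apply] at h2
      omega
  · rw [Set.disjoint_left]
    rintro _ h ⟨τ, h', rfl⟩
    have hav := (isSeparablePerm_iff τ).1 h'.1
    obtain ⟨d, hd, hdn, hs | hs⟩ := hav.exists_splitAt (by omega) (wordOf_injOn τ)
    · exact h'.2 d hd hdn hs
    · exact h.2 d hd hdn (hs.congr (sameOrder_complementPerm τ) hd.le hdn.le)

theorem separablePerms_one : separablePerms 1 = Set.univ := by
  ext σ
  simp only [separablePerms, Set.mem_ofPred_eq, Set.mem_univ, iff_true, isSeparablePerm_iff]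
  exact fun p q r s _ _ _ _ _ => by omega

/-- The separable permutations are counted by the large Schröder numbers. -/
theorem ncard_separablePerms_succ (n : ℕ) :
    (separablePerms (n + 1)).ncard = Nat.largeSchroder n := by
  have h1 : (separablePerms 1).ncard = 1 := by
    rw [separablePerms_one, Set.ncard_univ, Nat.card_eq_fintype_card]
    rfl
  induction n using Nat.strong_induction_on with
  | _ n ih =>
  rcases n with _ | m
  · simpa using h1
  have hrec := ncard_separablePerms (n := m + 2) (m + 1)
  have htwo := two_mul_ncard_sumIndecomposables (n := m + 2) (by omega)
  -- Doubling turns sum-indecomposables of size `i + 1` into `S_i` for `i ≥ 1`. For `i = 0` the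
  -- single permutation of size one counts as `2 = S_0 + 1`, whence the extra `S_m`.
  have hsum : 2 * ∑ i ∈ Finset.range (m + 1), (firstSplits (m + 2) (i + 1)).ncard =
      m.largeSchroder + ∑ i ∈ Finset.range (m + 1),
        i.largeSchroder * (m - i).largeSchroder := by
    have hterm : ∀ i ∈ Finset.range (m + 1), 2 * (firstSplits (m + 2) (i + 1)).ncard =
        2 * (sumIndecomposables (i + 1) (i + 1)).ncard * (m - i).largeSchroder := by
      intro i hi
      rw [Finset.mem_range] at hi
      obtain ⟨l, rfl⟩ := Nat.exists_eq_add_of_le (Nat.lt_succ_iff.1 hi)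
      have := ncard_firstSplits (i + 1) (l + 1)
      rw [show i + 1 + (l + 1) = i + l + 2 by ring, ih l (by omega)] at this
      rw [this, Nat.add_sub_cancel_left, mul_assoc]
    rw [Finset.mul_sum, Finset.sum_congr rfl hterm, Finset.sum_range_succ', Finset.sum_range_succ']
    have hind : (sumIndecomposables (0 + 1) (0 + 1)).ncard = 1 := by
      rw [zero_add, sumIndecomposables_one, h1]
    rw [hind, Finset.sum_congr rfl fun i hi => by
      rw [two_mul_ncard_sumIndecomposables (by omega),
        ih (i + 1) (by have := Finset.mem_range.1 hi; omega)]]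
    simp
    ring
  rw [Nat.largeSchroder_succ, ← Nat.range_succ_eq_Iic]
  change (separablePerms (m + 2)).ncard = _ + ∑ i ∈ Finset.range (m + 1), _
  change _ = (sumIndecomposables (m + 2) (m + 2)).ncard + _ at hrec
  omega

/-! ### Counting interval posets -/

theorem twoRealizerPosets_eq_image (n : ℕ) : twoRealizerPosets n =
    (fun σ : Equiv.Perm (Fin n) => intervalPoset ⟨n, σ⟩) ''
      {σ | (realizers (intervalPoset ⟨n, σ⟩)).encard = 2} := by
  ext P
  constructor
  · rintro ⟨⟨σ, rfl⟩, h⟩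
    exact ⟨σ, h, rfl⟩
  · rintro ⟨σ, h, rfl⟩
    exact ⟨⟨σ, rfl⟩, h⟩

theorem finite_twoRealizerPosets (n : ℕ) : (twoRealizerPosets n).Finite := by
  rw [twoRealizerPosets_eq_image]
  exact (Set.toFinite _).image _

/-- Over each such poset the fibre of the map from permutations is a pair `{σ, complementPerm σ}`.
-/
theorem two_mul_ncard_twoRealizerPosets (hn : 2 ≤ n) : 2 * (twoRealizerPosets n).ncard =
    {σ : Equiv.Perm (Fin n) | (realizers (intervalPoset ⟨n, σ⟩)).encard = 2}.ncard := by
  classical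
  set T := {σ : Equiv.Perm (Fin n) | (realizers (intervalPoset ⟨n, σ⟩)).encard = 2} with hT
  rw [twoRealizerPosets_eq_image, ← hT, Set.ncard_eq_toFinset_card' T,
    Set.ncard_eq_toFinset_card' (_ '' T), Set.toFinset_image,
    Finset.card_eq_sum_card_image (fun σ : Equiv.Perm (Fin n) => intervalPoset ⟨n, σ⟩) T.toFinset,
    Finset.sum_const_nat (m := 2), mul_comm]
  intro P hP
  obtain ⟨σ, hσ, rfl⟩ := Finset.mem_image.1 hP
  rw [Set.mem_toFinset] at hσ
  rw [← Finset.card_pair (complementPerm_ne hn σ).symm]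
  congr 1
  ext τ
  have h2 := (encard_realizers_eq_two_iff hn σ).1 hσ τ
  simp only [Finset.mem_filter, Set.mem_toFinset, Finset.mem_insert, Finset.mem_singleton]
  constructor
  · exact fun h => h2 ((intervalPoset_eq_iff σ τ).1 h.2)
  · intro h
    have h3 : intervalPoset ⟨n, τ⟩ = intervalPoset ⟨n, σ⟩ := by
      rcases h with rfl | rfl
      · rfl
      · exact (intervalPoset_eq_iff _ _).2 (sameBlocks_complementPerm σ)
    refine ⟨?_, h3⟩
    rw [hT, Set.mem_ofPred_eq, h3]
    exact hσ

theorem encard_twoRealizerPosets (hn : 2 ≤ n) (h4 : n ≠ 4) :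
    (twoRealizerPosets n).encard = (Nat.smallSchroder n : ℕ∞) := by
  rw [← (finite_twoRealizerPosets n).cast_ncard_eq, Nat.cast_inj]
  have h := two_mul_ncard_twoRealizerPosets hn
  have hT : {σ : Equiv.Perm (Fin n) | (realizers (intervalPoset ⟨n, σ⟩)).encard = 2} =
      separablePerms n := by
    ext σ
    simp [encard_realizers_eq_two_iff_isSeparablePerm, separablePerms, hn, h4]
  obtain ⟨m, rfl⟩ := Nat.exists_eq_add_of_le' (show 1 ≤ n by omega)
  rw [hT, ncard_separablePerms_succ, ← Nat.two_mul_smallSchroder_succ (by omega)] at h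
  omega

theorem largeSchroder_three : Nat.largeSchroder 3 = 22 := by
  rw [Nat.largeSchroder_succ, ← Nat.range_succ_eq_Iic]
  simp [Finset.sum_range_succ]

theorem encard_twoRealizerPosets_four :
    (twoRealizerPosets 4).encard = (Nat.smallSchroder 4 : ℕ∞) + 1 := by
  rw [← (finite_twoRealizerPosets 4).cast_ncard_eq]
  have h := two_mul_ncard_twoRealizerPosets (n := 4) (by norm_num)
  have hT : {σ : Equiv.Perm (Fin 4) | (realizers (intervalPoset ⟨4, σ⟩)).encard = 2} =
      separablePerms 4 ∪ {perm2413, perm3142} := by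
    ext σ
    have := not_isSeparablePerm_iff_of_four σ
    simp only [encard_realizers_eq_two_iff_isSeparablePerm, separablePerms, Set.mem_union,
      Set.mem_ofPred_eq, Set.mem_insert_iff, Set.mem_singleton_iff, ← this]
    simp [em]
  rw [hT, Set.ncard_union_eq, ncard_separablePerms_succ,
    ← Nat.two_mul_smallSchroder_succ (by norm_num), Set.ncard_pair] at h
  · change _ = 2 * Nat.smallSchroder 4 + 2 at h
    exact_mod_cast (show (twoRealizerPosets 4).ncard = Nat.smallSchroder 4 + 1 by omega)
  · rw [← complementPerm_perm2413]
    exact (complementPerm_ne (by norm_num) _).symm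
  · rw [Set.disjoint_left]
    exact fun σ h h' => (not_isSeparablePerm_iff_of_four σ).2 h' h

theorem mainTheorem4 :
    (∀ σ : Permutation,
      (realizers (intervalPoset σ)).encard = 2 ↔
        (2 ≤ σ.1 ∧ IsSeparablePerm σ.2) ∨
          σ = (⟨4, perm2413⟩ : Permutation) ∨ σ = (⟨4, perm3142⟩ : Permutation)) ∧
    (twoRealizerPosets 1).encard = 0 ∧
    ((twoRealizerPosets 2).encard = (Nat.smallSchroder 2 : ℕ∞) ∧ Nat.smallSchroder 2 = 1) ∧
    ((twoRealizerPosets 3).encard = (Nat.smallSchroder 3 : ℕ∞) ∧ Nat.smallSchroder 3 = 3) ∧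
    ((twoRealizerPosets 4).encard = (Nat.smallSchroder 4 : ℕ∞) + 1 ∧
      (Nat.smallSchroder 4 : ℕ∞) + 1 = 12) ∧
    ∀ n : ℕ, 5 ≤ n → (twoRealizerPosets n).encard = (Nat.smallSchroder n : ℕ∞) := by
  refine ⟨encard_realizers_eq_two_iff_pattern, ?_,
    ⟨encard_twoRealizerPosets le_rfl (by norm_num), ?_⟩,
    ⟨encard_twoRealizerPosets (by norm_num) (by norm_num), ?_⟩,
    ⟨encard_twoRealizerPosets_four, ?_⟩,
    fun n hn => encard_twoRealizerPosets (by omega) (by omega)⟩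
  · rw [Set.encard_eq_zero, Set.eq_empty_iff_forall_notMem]
    rintro P ⟨⟨σ, rfl⟩, h⟩
    exact encard_realizers_ne_two_of_size_le_one le_rfl σ h
  · simp [Nat.smallSchroder]
  · simp [Nat.smallSchroder]
  · have : Nat.smallSchroder 4 = 11 := by simp [Nat.smallSchroder, largeSchroder_three]
    rw [this]
    norm_num
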